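/- Let $\zeta:\mathbb{R}\to[0,\infty)$ be even and integrable with $\int_{\mathbb{R}}\zeta=1$, and suppose that its Fourier transform $\hat\zeta(s)=\int_{\mathbb{R}}e^{-isx}\zeta(x)\,dx$ satisfies $\hat\zeta(s)>0$ for all $s$ and $\hat\zeta(s)\le C(1+|s|)^{-1/2-\delta}$ for some constants $C$ and $\delta>0$. For $\varepsilon>0$ put $R_\varepsilon(x)=\frac1\varepsilon\zeta(x/\varepsilon)$. Consider the nonlocal Gross--Pitaevskii equation $$ i\partial_t\psi=-\tfrac12\partial_x^2\psi+\psi\,(R_\varepsilon*|\psi|^2)+V_0\sin^2(kx)\,\psi ,\qquad k>0, $$ and its traveling wave solution $\psi(x,t)=(u(x)+iv(x))e^{-i\omega t}$ with $$u(x)=\sqrt{B}\cos(kx),\qquad v(x)=\sqrt{B+A}\,\sin(kx),\qquad \beta=\int_{\mathbb{R}}R_\varepsilon(x)\cos(2kx)\,dx,$$ $$A=-\frac{V_0}{\beta},\qquad \omega=\frac{V_0+k^2}{2}+B-\frac{V_0}{2\beta}.$$ Let $S=-\frac12\partial_x^2+V_0\sin^2(kx)-\omega+R_\varepsilon*(u^2+v^2)$,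 and let $$ JL\begin{pmatrix}w\\z\end{pmatrix}=\begin{pmatrix}0&1\\-1&0\end{pmatrix}\begin{pmatrix}Sw+2u\,R_\varepsilon*(uw+vz)\\ Sz+2v\,R_\varepsilon*(uw+vz)\end{pmatrix} $$ be the linearization of the equation at this wave, in the frame rotating with frequency $\omega$. Then for every $k>0$ and $\varepsilon>0$ there are $B^*$ and $v^*>0$, depending only on $\zeta$, $k$ and $\varepsilon$, such that for all $B>B^*$, all $V_0<0$ with $|V_0|<v^*$, and all integers $n\ge1$, the wave is spectrally stable under perturbations of period $2\pi n/k$: the spectrum of $JL$ as an unbounded operator on $L^2\times L^2$ of the circle of length $2\pi n/k$ (complex-valued functions), with domain $H^2\times H^2$, lies on the imaginary axis. -/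

import Mathlib

open MeasureTheory AddCircle
open scoped Real ENNReal

noncomputable section

namespace NonlocalGP

/-! ### The interaction kernel -/

/-- The Fourier transform `ζ̂(s) = ∫ e^{-isx} ζ(x) dx`. -/
def hat (ζ : ℝ → ℝ) (s : ℝ) : ℂ :=
  ∫ x : ℝ, Complex.exp (-(Complex.I * s * x)) * (ζ x : ℂ)

/-- The standing hypotheses on the kernel profile `ζ`. Since `ζ` is even, `ζ̂` is real, so that
positivity of `ζ̂` is positivity of its real part. -/
structure IsAdmissible (ζ : ℝ → ℝ) : Prop where
  nonneg : ∀ x, 0 ≤ ζ x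
  even : ∀ x, ζ (-x) = ζ x
  integrable : Integrable ζ
  integral_eq_one : ∫ x, ζ x = 1
  hat_pos : ∀ s, 0 < (hat ζ s).re
  hat_decay : ∃ C δ : ℝ, 0 < δ ∧ ∀ s, ‖hat ζ s‖ ≤ C * (1 + |s|) ^ (-(1 / 2 : ℝ) - δ)

/-- The rescaled kernel `R(x; ε) = ε⁻¹ ζ(x / ε)`. -/
def R (ζ : ℝ → ℝ) (ε x : ℝ) : ℝ := 1 / ε * ζ (x / ε)

lemma integrable_R {ζ : ℝ → ℝ} (hζ : Integrable ζ) (ε : ℝ) : Integrable (R ζ ε) := by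
  rcases eq_or_ne ε 0 with rfl | h
  · have : R ζ 0 = 0 := by funext x; simp [R]
    rw [this]; exact integrable_zero _ _ _
  · exact (hζ.comp_div h).const_mul (1 / ε)

/-! ### The travelling wave `ψ(x,t) = (u(x) + i v(x)) e^{-iωt}` -/

/-- `β(k; ε) = ∫ R(x; ε) cos(2kx) dx`. -/
def β (ζ : ℝ → ℝ) (k ε : ℝ) : ℝ := ∫ x : ℝ, R ζ ε x * Real.cos (2 * k * x)

/-- `A = -V₀ / β(k; ε)`. -/
def A (ζ : ℝ → ℝ) (k ε V₀ : ℝ) : ℝ := -V₀ / β ζ k ε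

/-- The frequency `ω = (V₀ + k²)/2 + B - V₀ / (2 β(k; ε))`. -/
def ω (ζ : ℝ → ℝ) (k ε B V₀ : ℝ) : ℝ := (V₀ + k ^ 2) / 2 + B - V₀ / (2 * β ζ k ε)

/-- The potential `V(x) = V₀ sin²(kx)`. -/
def V (k V₀ x : ℝ) : ℝ := V₀ * Real.sin (k * x) ^ 2

/-- Real part of the wave profile, `√B cos(kx)`. -/
def waveRe (k B x : ℝ) : ℝ := √B * Real.cos (k * x)

/-- Imaginary part of the wave profile, `√(B + A) sin(kx)`. -/
def waveIm (ζ : ℝ → ℝ) (k ε B V₀ x : ℝ) : ℝ := √(B + A ζ k ε V₀) * Real.sin (k * x)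

/-- `|ψ|²`, the density of the wave. -/
def density (ζ : ℝ → ℝ) (k ε B V₀ x : ℝ) : ℝ :=
  waveRe k B x ^ 2 + waveIm ζ k ε B V₀ x ^ 2

/-- The total potential `V - ω + R_ε ∗ |ψ|²` that multiplies the perturbation in the
linearization. -/
def totalPotential (ζ : ℝ → ℝ) (k ε B V₀ x : ℝ) : ℝ :=
  V k V₀ x - ω ζ k ε B V₀ + ∫ y : ℝ, R ζ ε y * density ζ k ε B V₀ (x - y)

/-! ### The circle of length `2πn/k` and operators on `L²` of it -/

/-- The period `2πn/k` of the perturbations. -/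
def period (k : ℝ) (n : ℕ+) : ℝ := 2 * π * (n : ℕ) / k

instance instFactPeriod (k : ℝ) [hk : Fact (0 < k)] (n : ℕ+) : Fact (0 < period k n) :=
  ⟨div_pos (mul_pos Real.two_pi_pos (Nat.cast_pos.2 n.pos)) hk.out⟩

section Circle

variable {T : ℝ} [hT : Fact (0 < T)]

variable (T) in
/-- Complex-valued `L²` on the circle of length `T`. (The measure is Lebesgue measure divided by
`T`, which rescales the norm by a constant factor.) -/
abbrev L2 : Type := Lp ℂ 2 (haarAddCircle (T := T))

variable (T) in
/-- The `L²` space of pairs `(w, z)`. -/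
abbrev L2Pair : Type := WithLp 2 (L2 T × L2 T)

/-- The product of a continuous `T`-periodic real function on `ℝ` with an `L²` function. -/
def mulOp (g : ℝ → ℝ) (hg : Continuous g) (hp : Function.Periodic g T) : L2 T →ₗ[ℂ] L2 T :=
  have hm (f : L2 T) : MemLp (fun x : AddCircle T => (hp.lift x : ℂ) * f x) 2 haarAddCircle := by
    have hc : Continuous fun x : AddCircle T => (hp.lift x : ℂ) :=
      Complex.continuous_ofReal.comp (continuous_coinduced_dom.2 hg)
    refine (Lp.memLp f).of_le_mul (c := ‖(⟨_, hc⟩ : C(AddCircle T, ℂ))‖)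
      (hc.aestronglyMeasurable.mul (Lp.aestronglyMeasurable f)) ?_
    refine Filter.Eventually.of_forall fun x => ?_
    rw [norm_mul]
    exact mul_le_mul_of_nonneg_right
      (ContinuousMap.norm_coe_le_norm (⟨_, hc⟩ : C(AddCircle T, ℂ)) x) (norm_nonneg _)
  { toFun := fun f => (hm f).toLp _
    map_add' := fun f₁ f₂ => by
      rw [← MemLp.toLp_add]
      refine MemLp.toLp_congr _ _ ?_
      filter_upwards [Lp.coeFn_add f₁ f₂] with x hx
      simp only [Pi.add_apply] at hx ⊢
      rw [hx, mul_add]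
    map_smul' := fun c f => by
      rw [RingHom.id_apply, ← MemLp.toLp_const_smul]
      refine MemLp.toLp_congr _ _ ?_
      filter_upwards [Lp.coeFn_smul c f] with x hx
      simp only [Pi.smul_apply, smul_eq_mul] at hx ⊢
      rw [hx]; ring }

/-- The translation `(τ_y f)(x) = f(x - y)` on `L²` of the circle. -/
def translate (y : ℝ) : L2 T →ₗᵢ[ℂ] L2 T :=
  Lp.compMeasurePreservingₗᵢ ℂ (fun x : AddCircle T => x - (y : AddCircle T))
    (measurePreserving_sub_right haarAddCircle (y : AddCircle T))

lemma continuous_translate (f : L2 T) : Continuous fun y : ℝ => translate y f := by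
  let g : ℝ × AddCircle T → AddCircle T := fun p => p.2 - (p.1 : AddCircle T)
  have hg : Continuous g :=
    continuous_snd.sub ((AddCircle.continuous_mk' T).comp continuous_fst)
  exact (continuous_const (y := f)).compMeasurePreservingLp
    (ContinuousMap.curry ⟨g, hg⟩).continuous
    (fun y => measurePreserving_sub_right haarAddCircle (y : AddCircle T)) (by simp)

/-- Convolution of a periodic `L²` function with an integrable kernel on the line,
`(ρ ∗ f)(x) = ∫_ℝ ρ(y) f(x - y) dy`, as an `L²`-valued integral. -/
def convOp (ρ : ℝ → ℝ) (hρ : Integrable ρ) : L2 T →ₗ[ℂ] L2 T :=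
  have hi (f : L2 T) : Integrable fun y : ℝ => (ρ y : ℂ) • translate y f := by
    refine (hρ.ofReal (𝕜 := ℂ)).smul_bdd ‖f‖
      (continuous_translate f).aestronglyMeasurable ?_
    exact Filter.Eventually.of_forall fun y => ((translate y).norm_map f).le
  { toFun := fun f => ∫ y : ℝ, (ρ y : ℂ) • translate y f
    map_add' := fun f₁ f₂ => by
      rw [← integral_add (hi f₁) (hi f₂)]
      simp only [map_add, smul_add]
    map_smul' := fun c f => by
      rw [RingHom.id_apply, ← integral_smul]
      simp only [map_smul, smul_comm c] }

variable (T) in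
/-- The Sobolev space `H₂` of the circle, `∑ (1 + 4π²j²/T²)² |f̂ⱼ|² < ∞`. -/
def H2 : Submodule ℂ (L2 T) where
  carrier := {f | Summable fun j : ℤ =>
    (1 + 4 * π ^ 2 * (j : ℝ) ^ 2 / T ^ 2) ^ 2 * ‖fourierCoeff f j‖ ^ 2}
  zero_mem' := by
    simp only [Set.mem_ofPred_eq, ← fourierBasis_repr, map_zero]
    simp
  add_mem' := by
    intro f g hf hg
    simp only [Set.mem_ofPred_eq, ← fourierBasis_repr, map_add] at hf hg ⊢
    refine Summable.of_nonneg_of_le (fun j => by positivity) (fun j => ?_)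
      ((hf.mul_left 2).add (hg.mul_left 2))
    have h1 := norm_add_le (fourierBasis.repr f j) (fourierBasis.repr g j)
    have h2 : ‖fourierBasis.repr f j + fourierBasis.repr g j‖ ^ 2 ≤
        2 * ‖fourierBasis.repr f j‖ ^ 2 + 2 * ‖fourierBasis.repr g j‖ ^ 2 := by
      nlinarith [norm_nonneg (fourierBasis.repr f j + fourierBasis.repr g j),
        sq_nonneg (‖fourierBasis.repr f j‖ - ‖fourierBasis.repr g j‖)]
    have h3 := mul_le_mul_of_nonneg_left h2
      (sq_nonneg (1 + 4 * π ^ 2 * (j : ℝ) ^ 2 / T ^ 2))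
    simp only [lp.coeFn_add, Pi.add_apply]
    linarith
  smul_mem' := by
    intro c f hf
    simp only [Set.mem_ofPred_eq, ← fourierBasis_repr, map_smul] at hf ⊢
    refine (hf.mul_left (‖c‖ ^ 2)).congr fun j => ?_
    simp only [lp.coeFn_smul, Pi.smul_apply, norm_smul]
    ring

lemma memlp_secondDeriv (f : H2 T) :
    Memℓp (fun j : ℤ => -((4 * π ^ 2 * (j : ℝ) ^ 2 / T ^ 2 : ℝ) : ℂ) *
      fourierBasis.repr (f : L2 T) j) 2 := by
  refine memℓp_gen ?_
  have hf : Summable fun j : ℤ =>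
    (1 + 4 * π ^ 2 * (j : ℝ) ^ 2 / T ^ 2) ^ 2 * ‖fourierCoeff (f : L2 T) j‖ ^ 2 := f.2
  refine Summable.of_nonneg_of_le (fun j => by positivity) (fun j => ?_) hf
  have h0 : 0 ≤ 4 * π ^ 2 * (j : ℝ) ^ 2 / T ^ 2 := by positivity
  rw [← fourierBasis_repr, norm_mul, norm_neg, Complex.norm_real, Real.norm_of_nonneg h0]
  simp only [ENNReal.toReal_ofNat, Real.rpow_ofNat, mul_pow]
  gcongr
  linarith

/-- The second derivative `∂ₓ²` on `H₂`: the `j`-th Fourier coefficient is multiplied by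
`(2πij/T)² = -4π²j²/T²`. -/
def secondDeriv : H2 T →ₗ[ℂ] L2 T where
  toFun f := fourierBasis.repr.symm ⟨_, memlp_secondDeriv f⟩
  map_add' f g := by
    rw [← map_add]
    congr 1
    ext j
    simp only [lp.coeFn_add, Pi.add_apply, Submodule.coe_add, map_add, mul_add]
  map_smul' c f := by
    rw [RingHom.id_apply, ← map_smul]
    congr 1
    ext j
    simp only [lp.coeFn_smul, Pi.smul_apply, Submodule.coe_smul, map_smul, smul_eq_mul]
    ring

end Circle

/-! ### The linearization -/

lemma periodic_trig (k : ℝ) [hk : Fact (0 < k)] (n : ℕ+) (x : ℝ) :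
    k * (x + period k n) = k * x + (n : ℕ) * (2 * π) := by
  have := hk.out.ne'
  unfold period
  field_simp

lemma continuous_waveRe (k B : ℝ) : Continuous (waveRe k B) := by
  unfold waveRe; fun_prop

lemma continuous_waveIm (ζ : ℝ → ℝ) (k ε B V₀ : ℝ) : Continuous (waveIm ζ k ε B V₀) := by
  unfold waveIm; fun_prop

lemma periodic_waveRe (k B : ℝ) [Fact (0 < k)] (n : ℕ+) :
    Function.Periodic (waveRe k B) (period k n) := fun x => by
  simp only [waveRe, periodic_trig, Real.cos_add_nat_mul_two_pi]

lemma periodic_waveIm (ζ : ℝ → ℝ) (k ε B V₀ : ℝ) [Fact (0 < k)] (n : ℕ+) :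
    Function.Periodic (waveIm ζ k ε B V₀) (period k n) := fun x => by
  simp only [waveIm, periodic_trig, Real.sin_add_nat_mul_two_pi]

lemma periodic_totalPotential (ζ : ℝ → ℝ) (k ε B V₀ : ℝ) [Fact (0 < k)] (n : ℕ+) :
    Function.Periodic (totalPotential ζ k ε B V₀) (period k n) := fun x => by
  have h (y : ℝ) : density ζ k ε B V₀ (x + period k n - y) = density ζ k ε B V₀ (x - y) := by
    rw [add_sub_right_comm]
    simp only [density, periodic_waveRe k B n (x - y), periodic_waveIm ζ k ε B V₀ n (x - y)]
  simp only [totalPotential, V, periodic_trig, Real.sin_add_nat_mul_two_pi, h]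

lemma continuous_totalPotential {ζ : ℝ → ℝ} (hζ : Integrable ζ) (k ε B V₀ : ℝ) :
    Continuous (totalPotential ζ k ε B V₀) := by
  have hd : Continuous (density ζ k ε B V₀) :=
    ((continuous_waveRe k B).pow 2).add ((continuous_waveIm ζ k ε B V₀).pow 2)
  have hb (x : ℝ) : ‖density ζ k ε B V₀ x‖ ≤ √B ^ 2 + √(B + A ζ k ε V₀) ^ 2 := by
    have h1 := Real.cos_sq_le_one (k * x)
    have h2 := Real.sin_sq_le_one (k * x)
    rw [Real.norm_of_nonneg (by unfold density; positivity)]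
    simp only [density, waveRe, waveIm, mul_pow]
    nlinarith [sq_nonneg (√B), sq_nonneg (√(B + A ζ k ε V₀))]
  have hc : Continuous fun x => ∫ y : ℝ, R ζ ε y * density ζ k ε B V₀ (x - y) := by
    refine continuous_of_dominated
      (bound := fun y => ‖R ζ ε y‖ * (√B ^ 2 + √(B + A ζ k ε V₀) ^ 2)) (fun x => ?_) (fun x => ?_)
      ((integrable_R hζ ε).norm.mul_const _) ?_
    · exact (integrable_R hζ ε).aestronglyMeasurable.mul
        (hd.comp (continuous_const.sub continuous_id)).aestronglyMeasurable
    · refine Filter.Eventually.of_forall fun y => ?_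
      rw [norm_mul]
      exact mul_le_mul_of_nonneg_left (hb _) (norm_nonneg _)
    · exact Filter.Eventually.of_forall fun y => by fun_prop
  unfold totalPotential V
  fun_prop

section Linearization

variable {ζ : ℝ → ℝ} (hζ : Integrable ζ) (k ε B V₀ : ℝ) [Fact (0 < k)] (n : ℕ+)

/-- Multiplication by the real part of the wave profile. -/
def mulRe : L2 (period k n) →ₗ[ℂ] L2 (period k n) :=
  mulOp (waveRe k B) (continuous_waveRe k B) (periodic_waveRe k B n)

variable (ζ) in
/-- Multiplication by the imaginary part of the wave profile. -/
def mulIm : L2 (period k n) →ₗ[ℂ] L2 (period k n) :=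
  mulOp (waveIm ζ k ε B V₀) (continuous_waveIm ζ k ε B V₀) (periodic_waveIm ζ k ε B V₀ n)

/-- The operator `-½ ∂ₓ² + V - ω + R_ε ∗ |ψ|²` on `H₂`. -/
def scalarPart : H2 (period k n) →ₗ[ℂ] L2 (period k n) :=
  (-(1 / 2 : ℂ)) • secondDeriv +
    mulOp (totalPotential ζ k ε B V₀) (continuous_totalPotential hζ k ε B V₀)
      (periodic_totalPotential ζ k ε B V₀ n) ∘ₗ (H2 (period k n)).subtype

/-- The nonlocal coupling `(w, z) ↦ R_ε ∗ (u w + v z)`, where `u + i v` is the wave profile. -/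
def coupling : L2 (period k n) × L2 (period k n) →ₗ[ℂ] L2 (period k n) :=
  convOp (R ζ ε) (integrable_R hζ ε) ∘ₗ
    (mulRe k B n).coprod (mulIm ζ k ε B V₀ n)

/-- The linearization `JL` at `ψ(x,t) = (u(x) + i v(x)) e^{-iωt}` of the equation
`i ψ_t = -½ ψ_xx + ψ (R_ε ∗ |ψ|²) + V ψ`: inserting
`((u + i v) + (w + i z)) e^{-iωt}` and keeping the terms linear in `(w, z)` gives
`∂_t (w, z) = JL (w, z)`, where `J (a, b) = (b, -a)` and
`L (w, z) = (S w + 2 u R_ε ∗ (u w + v z), S z + 2 v R_ε ∗ (u w + v z))`,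
`S = -½ ∂ₓ² + V - ω + R_ε ∗ |ψ|²`. Here it is written on `H₂ × H₂`, with complex-valued
`w` and `z`. -/
def JLfun : H2 (period k n) × H2 (period k n) →ₗ[ℂ] L2 (period k n) × L2 (period k n) :=
  let Q : H2 (period k n) × H2 (period k n) →ₗ[ℂ] L2 (period k n) :=
    coupling hζ k ε B V₀ n ∘ₗ
      (H2 (period k n)).subtype.prodMap (H2 (period k n)).subtype
  LinearMap.prod
    (scalarPart hζ k ε B V₀ n ∘ₗ LinearMap.snd ℂ _ _ + (2 : ℂ) • (mulIm ζ k ε B V₀ n ∘ₗ Q))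
    (-(scalarPart hζ k ε B V₀ n ∘ₗ LinearMap.fst ℂ _ _ + (2 : ℂ) • (mulRe k B n ∘ₗ Q)))

/-- `JL` as an unbounded operator on the Hilbert space of pairs of square-integrable functions of
period `2πn/k`, with domain `H₂ × H₂`. -/
def JL : L2Pair (period k n) →ₗ.[ℂ] L2Pair (period k n) where
  domain := ((H2 (period k n)).prod (H2 (period k n))).comap
    (WithLp.linearEquiv 2 ℂ (L2 (period k n) × L2 (period k n))).toLinearMap
  toFun :=
    { toFun := fun p => WithLp.toLp 2 (JLfun hζ k ε B V₀ n (⟨p.1.fst, p.2.1⟩, ⟨p.1.snd, p.2.2⟩))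
      map_add' := fun p q => congrArg (WithLp.toLp 2)
        ((JLfun hζ k ε B V₀ n).map_add (⟨p.1.fst, p.2.1⟩, ⟨p.1.snd, p.2.2⟩)
          (⟨q.1.fst, q.2.1⟩, ⟨q.1.snd, q.2.2⟩))
      map_smul' := fun c p => congrArg (WithLp.toLp 2)
        ((JLfun hζ k ε B V₀ n).map_smul c (⟨p.1.fst, p.2.1⟩, ⟨p.1.snd, p.2.2⟩)) }

end Linearization

/-! ### The spectrum of an unbounded operator -/

/-- The spectrum of an unbounded operator `𝓐` on `X`: `μ` lies outside it if and only if `𝓐 - μ`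
is a bijection of the domain onto `X` with bounded inverse `S`. -/
def spectrumOf {X : Type*} [NormedAddCommGroup X] [NormedSpace ℂ X] (𝓐 : X →ₗ.[ℂ] X) : Set ℂ :=
  {μ | ¬ ∃ S : X →L[ℂ] X,
    (∀ f : X, ∃ h : S f ∈ 𝓐.domain, 𝓐 ⟨S f, h⟩ - μ • S f = f) ∧
    ∀ p : 𝓐.domain, S (𝓐 p - μ • (p : X)) = p}

end NonlocalGP

end

/-! The linearization is J(S + P), where J(w, z) = (z, -w), S acts on each component and commutes
with J, and P is the bounded nonlocal coupling. The choice of A and ω makes the total potential the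
constant -k²/2 (`IsAdmissible.totalPotential_eq`), so S is the Fourier multiplier (s² - k²)/2. The
heart of the matter is that the energy ⟨x, (S + P)x⟩ is nonnegative.

S alone is negative at wavenumbers |s| < k, and P has to compensate. For real w, z put w + iz = (u +
iv)(p + iq). Up to a total derivative, twice the local energy is the integral of ρ(p'² + q'²) +
4jpq', where ρ = u² + v² and the Wronskian j = uv' - vu' is constant. Completing the square in q'
removes q, and what is left is bounded below through the density perturbation f = ρp = uw + vz
alone, by the integral of f'²/(4B) - (9k²/B)f² (`energy_density_ge`, `integral_energy_ge`). The
nonlocal part adds 4 R̂(s)|f̂(s)|² in each mode. For |s| > 6k the derivative term wins; for |s| ≤ 6k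
the transform R̂ has a positive minimum m, which wins once 4mB ≥ 9k²
(`energy_nonneg_of_represents`). Since m is a minimum over real frequencies, the threshold does not
depend on n.

The energy is degenerate: it vanishes on the phase direction (-v, u). The spectral conclusion
therefore uses only nonnegativity. Cauchy–Schwarz for the energy form bounds J(S + P) - μ from below
whenever Re μ ≠ 0 (`IsNonnegHamiltonian.exists_norm_le`). The same bound at -μ̄ shows that the range
is dense, because J turns the adjoint equation into the eigenvalue equation at -μ̄
(`IsNonnegHamiltonian.surjective_sub`). -/

noncomputable section

namespace NonlocalGP

/-! ### Hamiltonian operators with a nonnegative energy -/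

section Hamiltonian

open scoped InnerProductSpace ComplexConjugate

variable {H : Type*} [NormedAddCommGroup H] [InnerProductSpace ℂ H]

/-- `𝓐 = J (S + P)` with `J` a complex structure commuting with the symmetric operator `S`, `P`
bounded and symmetric, and the energy form of `S + P` nonnegative. -/
structure IsNonnegHamiltonian (J : H →ₗ[ℂ] H) (𝓐 : H →ₗ.[ℂ] H) (S : 𝓐.domain →ₗ[ℂ] H)
    (P : H →L[ℂ] H) : Prop where
  J_J : ∀ x, J (J x) = -x
  inner_J : ∀ x y, ⟪J x, y⟫_ℂ = -⟪x, J y⟫_ℂ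
  J_mem : ∀ x ∈ 𝓐.domain, J x ∈ 𝓐.domain
  S_J : ∀ x : 𝓐.domain, S ⟨J x, J_mem x x.2⟩ = J (S x)
  apply_eq : ∀ x : 𝓐.domain, 𝓐 x = J (S x + P x)
  S_symm : ∀ x y : 𝓐.domain, ⟪S x, (y : H)⟫_ℂ = ⟪(x : H), S y⟫_ℂ
  P_symm : ∀ x y, ⟪P x, y⟫_ℂ = ⟪x, P y⟫_ℂ
  energy_nonneg : ∀ x : 𝓐.domain, 0 ≤ (⟪(x : H), S x + P x⟫_ℂ).re

namespace IsNonnegHamiltonian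

variable {J : H →ₗ[ℂ] H} {𝓐 : H →ₗ.[ℂ] H} {S : 𝓐.domain →ₗ[ℂ] H} {P : H →L[ℂ] H}

lemma norm_J (h : IsNonnegHamiltonian J 𝓐 S P) (x : H) : ‖J x‖ = ‖x‖ := by
  have h1 : ⟪J x, J x⟫_ℂ = ⟪x, x⟫_ℂ := by rw [h.inner_J, h.J_J, inner_neg_right, neg_neg]
  rw [inner_self_eq_norm_sq_to_K, inner_self_eq_norm_sq_to_K] at h1
  have h2 : ‖J x‖ ^ 2 = ‖x‖ ^ 2 := by exact_mod_cast h1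
  exact (sq_eq_sq₀ (norm_nonneg _) (norm_nonneg _)).1 h2

lemma energy_symm (h : IsNonnegHamiltonian J 𝓐 S P) (x y : 𝓐.domain) :
    ⟪S x + P x, (y : H)⟫_ℂ = ⟪(x : H), S y + P y⟫_ℂ := by
  rw [inner_add_left, inner_add_right, h.S_symm, h.P_symm]

lemma energy_im (h : IsNonnegHamiltonian J 𝓐 S P) (x : 𝓐.domain) :
    (⟪(x : H), S x + P x⟫_ℂ).im = 0 := by
  rw [← Complex.conj_eq_iff_im, inner_conj_symm, h.energy_symm]

/-- The energy is a positive semidefinite Hermitian form on the domain; Cauchy–Schwarz tolerates its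
kernel. -/
lemma energy_cauchy_schwarz (h : IsNonnegHamiltonian J 𝓐 S P) (x y : 𝓐.domain) :
    ‖⟪(x : H), S y + P y⟫_ℂ‖ ^ 2 ≤
      (⟪(x : H), S x + P x⟫_ℂ).re * (⟪(y : H), S y + P y⟫_ℂ).re := by
  let core : PreInnerProductSpace.Core ℂ 𝓐.domain :=
    { inner := fun x y => ⟪(x : H), S y + P y⟫_ℂ
      conj_inner_symm := fun x y => by
        change conj ⟪(y : H), S x + P x⟫_ℂ = ⟪(x : H), S y + P y⟫_ℂ
        rw [inner_conj_symm, h.energy_symm]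
      re_inner_nonneg := h.energy_nonneg
      add_left := fun x y z => by
        change ⟪((x + y : 𝓐.domain) : H), S z + P z⟫_ℂ = _
        rw [Submodule.coe_add, inner_add_left]
      smul_left := fun x y r => by
        change ⟪((r • x : 𝓐.domain) : H), S y + P y⟫_ℂ = _
        rw [Submodule.coe_smul, inner_smul_left] }
  have key := @InnerProductSpace.Core.inner_mul_inner_self_le ℂ 𝓐.domain _ _ _ core x y
  change ‖⟪(x : H), S y + P y⟫_ℂ‖ * ‖⟪(y : H), S x + P x⟫_ℂ‖ ≤ _ at key
  rwa [← h.energy_symm y x, norm_inner_symm (S y + P y), ← sq] at key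

lemma J_inner_self_re (h : IsNonnegHamiltonian J 𝓐 S P) (x : H) : (⟪J x, x⟫_ℂ).re = 0 := by
  have h1 := congrArg Complex.re (h.inner_J x x)
  have h2 := congrArg Complex.re (inner_conj_symm x (J x))
  simp only [Complex.conj_re, Complex.neg_re] at h1 h2
  linarith

/-- The energy controls `‖(𝓐 - μ) x‖` from below. -/
lemma energy_le (h : IsNonnegHamiltonian J 𝓐 S P) {μ : ℂ} (hμ : μ.re ≠ 0) (x : 𝓐.domain) :
    (⟪(x : H), S x + P x⟫_ℂ).re ≤
      (1 + |μ.im| / |μ.re|) * (‖𝓐 x - μ • (x : H)‖ * ‖(x : H)‖) := by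
  set f := 𝓐 x - μ • (x : H) with hf
  set c := (⟪J x, (x : H)⟫_ℂ).im with hc
  have hre := h.J_inner_self_re x
  -- Pairing with `J x` isolates the energy. As ⟪J x, x⟫ = ic is imaginary, the imaginary part of
  -- the identity controls c through Re μ ≠ 0, and the real part then controls the energy.
  have e1 : ⟪J x, f⟫_ℂ = ⟪(x : H), S x + P x⟫_ℂ - μ * ⟪J x, (x : H)⟫_ℂ := by
    rw [hf, inner_sub_right, inner_smul_right, h.apply_eq, h.inner_J x (J _), h.J_J,
      inner_neg_right, neg_neg]
  have er := congrArg Complex.re e1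
  have ei := congrArg Complex.im e1
  simp only [Complex.sub_re, Complex.sub_im, Complex.mul_re, Complex.mul_im, hre, h.energy_im,
    ← hc, mul_zero, zero_sub, add_zero] at er ei
  have hn : ‖⟪J x, f⟫_ℂ‖ ≤ ‖f‖ * ‖(x : H)‖ := by
    have := norm_inner_le_norm (𝕜 := ℂ) (J x) f
    rwa [h.norm_J, mul_comm] at this
  have hr := (le_abs_self _).trans ((Complex.abs_re_le_norm ⟪J x, f⟫_ℂ).trans hn)
  have hi := (Complex.abs_im_le_norm ⟪J x, f⟫_ℂ).trans hn
  rw [ei, abs_neg, abs_mul] at hi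
  have hpos : 0 < |μ.re| := abs_pos.2 hμ
  have hcb : |c| ≤ ‖f‖ * ‖(x : H)‖ / |μ.re| := by
    rw [le_div_iff₀ hpos]; linarith
  have h3 : -(μ.im * c) ≤ |μ.im| * (‖f‖ * ‖(x : H)‖ / |μ.re|) := by
    refine (neg_le_abs _).trans ?_
    rw [abs_mul]
    exact mul_le_mul_of_nonneg_left hcb (abs_nonneg _)
  have h4 : (1 + |μ.im| / |μ.re|) * (‖f‖ * ‖(x : H)‖) =
      ‖f‖ * ‖(x : H)‖ + |μ.im| * (‖f‖ * ‖(x : H)‖ / |μ.re|) := by ring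
  rw [h4]
  linarith

/-- `S` commutes with `J` and contributes equally at `x` and `J x`; only the bounded `P` makes a
difference. -/
lemma energy_J_le (h : IsNonnegHamiltonian J 𝓐 S P) (x : 𝓐.domain) :
    (⟪J x, S ⟨J x, h.J_mem x x.2⟩ + P (J x)⟫_ℂ).re ≤
      (⟪(x : H), S x + P x⟫_ℂ).re + 2 * ‖P‖ * ‖(x : H)‖ ^ 2 := by
  have hb (y : H) (hy : ‖y‖ = ‖(x : H)‖) : |(⟪y, P y⟫_ℂ).re| ≤ ‖P‖ * ‖(x : H)‖ ^ 2 := by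
    refine (Complex.abs_re_le_norm _).trans ((norm_inner_le_norm _ _).trans ?_)
    have := P.le_opNorm y
    rw [hy] at this ⊢
    nlinarith [norm_nonneg (x : H)]
  have h1 := (abs_le.1 (hb x rfl)).1
  have h2 := (abs_le.1 (hb (J x) (h.norm_J x))).2
  rw [h.S_J, inner_add_right, inner_add_right, Complex.add_re, Complex.add_re, h.inner_J x (J _),
    h.J_J, inner_neg_right, neg_neg]
  linarith

/-- `𝓐 - μ` is bounded below when `μ` is not imaginary. -/
lemma exists_norm_le (h : IsNonnegHamiltonian J 𝓐 S P) {μ : ℂ} (hμ : μ.re ≠ 0) :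
    ∃ C : ℝ, ∀ x : 𝓐.domain, ‖(x : H)‖ ≤ C * ‖𝓐 x - μ • (x : H)‖ := by
  set a := 1 + |μ.im| / |μ.re|
  set b := 2 * ‖P‖
  have ha : 0 ≤ a := by positivity
  have hb : 0 ≤ b := by positivity
  have hm : 0 < ‖μ‖ := norm_pos_iff.2 fun h0 => hμ (by simp [h0])
  refine ⟨2 / ‖μ‖ * (1 + a + a * b / (2 * ‖μ‖)), fun x => ?_⟩
  rcases eq_or_ne (x : H) 0 with hx | hx
  · rw [hx, norm_zero]; positivity
  have hN : 0 < ‖(x : H)‖ := norm_pos_iff.2 hx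
  set f := 𝓐 x - μ • (x : H) with hf
  set N := ‖(x : H)‖
  set F := ‖f‖
  set Q := (⟪(x : H), S x + P x⟫_ℂ).re
  have hF : 0 ≤ F := norm_nonneg _
  have hQ0 : 0 ≤ Q := h.energy_nonneg x
  have hQ : Q ≤ a * (F * N) := h.energy_le hμ x
  set Y := ‖⟪J x, S x + P x⟫_ℂ‖
  have hY : Y ^ 2 ≤ (Q + b * N ^ 2) * Q :=
    (h.energy_cauchy_schwarz ⟨J x, h.J_mem x x.2⟩ x).trans
      (mul_le_mul_of_nonneg_right (h.energy_J_le x) hQ0)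
  -- Up to ⟪x, f⟫, the number μ‖x‖² is the energy form at (J x, x), which is small when the energy
  -- of `x` is.
  have hlow : ‖μ‖ * N ^ 2 ≤ Y + N * F := by
    have e : μ * ⟪(x : H), (x : H)⟫_ℂ = -⟪J x, S x + P x⟫_ℂ - ⟪(x : H), f⟫_ℂ := by
      rw [hf, inner_sub_right, inner_smul_right, h.apply_eq, h.inner_J]; ring
    have e2 := congrArg norm e
    rw [norm_mul, inner_self_eq_norm_sq_to_K, norm_pow] at e2
    simp only [Complex.coe_algebraMap, Complex.norm_real, norm_norm] at e2
    rw [e2]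
    refine (norm_sub_le _ _).trans ?_
    rw [norm_neg]
    exact add_le_add le_rfl (norm_inner_le_norm _ _)
  -- The cross term abFN equals 4pq with p = ‖μ‖N/2 and q = abF/(2‖μ‖), hence is at most (p + q)².
  -- The weights are such that p takes only half of the left side of `hlow`.
  have hY2 : Y ≤ N * (a * F + ‖μ‖ * N / 2 + a * b * F / (2 * ‖μ‖)) := by
    refine le_of_sq_le_sq ?_ (by positivity)
    have h1 : (Q + b * N ^ 2) * Q ≤ (a * (F * N) + b * N ^ 2) * (a * (F * N)) := by gcongr
    have h2 : (‖μ‖ * N / 2) * (a * b * F / (2 * ‖μ‖)) = a * b * F * N / 4 := by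
      field_simp
      ring
    set p := ‖μ‖ * N / 2
    set q := a * b * F / (2 * ‖μ‖)
    have hp : 0 ≤ p := by positivity
    have hq : 0 ≤ q := by positivity
    have h3 : (a * F + b * N) * (a * F) ≤ (a * F + p + q) ^ 2 := by
      have : 0 ≤ a * F := by positivity
      nlinarith [sq_nonneg (p - q), mul_nonneg this hp, mul_nonneg this hq]
    have h4 := mul_le_mul_of_nonneg_left h3 (sq_nonneg N)
    nlinarith
  have h5 : ‖μ‖ * N ≤ a * F + ‖μ‖ * N / 2 + a * b * F / (2 * ‖μ‖) + F := by
    refine le_of_mul_le_mul_left ?_ hN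
    nlinarith
  have h6 : 2 / ‖μ‖ * (1 + a + a * b / (2 * ‖μ‖)) * F =
      (2 / ‖μ‖) * (a * F + a * b * F / (2 * ‖μ‖) + F) := by ring
  rw [h6, div_mul_eq_mul_div, le_div_iff₀ hm]
  linarith

variable [CompleteSpace H]

lemma surjective_sub (h : IsNonnegHamiltonian J 𝓐 S P)
    (hS : ∀ μ : ℂ, μ.re ≠ 0 → ∀ f : H, ∃ x : 𝓐.domain, J (S x) - μ • (x : H) = f)
    {μ : ℂ} (hμ : μ.re ≠ 0) (f : H) : ∃ x : 𝓐.domain, 𝓐 x - μ • (x : H) = f := by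
  -- The skew part `J S - μ` has a bounded inverse `G`.
  have hskew (x : 𝓐.domain) : |μ.re| * ‖(x : H)‖ ≤ ‖J (S x) - μ • (x : H)‖ := by
    have h1 : (⟪(x : H), J (S x)⟫_ℂ).re = 0 := by
      have e1 : ⟪(x : H), J (S x)⟫_ℂ = -⟪J x, S x⟫_ℂ := by rw [h.inner_J, neg_neg]
      have e2 : ⟪J x, S x⟫_ℂ = conj ⟪(x : H), J (S x)⟫_ℂ := by
        rw [inner_conj_symm, ← h.S_J, h.S_symm]
      have := congrArg Complex.re (e1.trans (congrArg Neg.neg e2))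
      simp only [Complex.neg_re, Complex.conj_re] at this
      linarith
    have e : ⟪(x : H), J (S x) - μ • (x : H)⟫_ℂ =
        ⟪(x : H), J (S x)⟫_ℂ - μ * ((‖(x : H)‖ ^ 2 : ℝ) : ℂ) := by
      rw [inner_sub_right, inner_smul_right, inner_self_eq_norm_sq_to_K]; simp
    have e' := congrArg Complex.re e
    rw [Complex.sub_re, h1, Complex.re_mul_ofReal, zero_sub] at e'
    have h2 := (Complex.abs_re_le_norm _).trans
      (norm_inner_le_norm (𝕜 := ℂ) (x : H) (J (S x) - μ • (x : H)))
    rw [e', abs_neg, abs_mul, abs_of_nonneg (sq_nonneg ‖(x : H)‖)] at h2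
    rcases eq_or_lt_of_le (norm_nonneg (x : H)) with h0 | h0
    · rw [← h0, mul_zero]; positivity
    · refine le_of_mul_le_mul_left ?_ h0
      linarith
  let K₀ : 𝓐.domain →ₗ[ℂ] H := J ∘ₗ S - μ • 𝓐.domain.subtype
  have hK₀ (x : 𝓐.domain) : K₀ x = J (S x) - μ • (x : H) := rfl
  have hbij : Function.Bijective K₀ := by
    refine ⟨(injective_iff_map_eq_zero K₀).2 fun x hx => ?_, hS μ hμ⟩
    have := hskew x
    rw [← hK₀, hx, norm_zero] at this
    have h0 : ‖(x : H)‖ ≤ 0 := by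
      by_contra! hlt
      exact absurd this (not_le.2 (mul_pos (abs_pos.2 hμ) hlt))
    exact Subtype.ext (norm_le_zero_iff.1 h0)
  let e := LinearEquiv.ofBijective K₀ hbij
  have he (g : H) : J (S (e.symm g)) - μ • (e.symm g : H) = g := e.apply_symm_apply g
  let G : H →L[ℂ] H := (𝓐.domain.subtype ∘ₗ e.symm.toLinearMap).mkContinuous (|μ.re|⁻¹) fun g => by
    have := hskew (e.symm g)
    rw [he] at this
    rw [inv_mul_eq_div, le_div_iff₀ (abs_pos.2 hμ), mul_comm]
    exact this
  have hG (g : H) : G g = (e.symm g : H) := rfl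
  obtain ⟨C, hC⟩ := h.exists_norm_le hμ
  -- `(𝓐 - μ) G = 1 + J P G` is bounded below with dense range.
  let Jc : H →L[ℂ] H := J.mkContinuous 1 fun x => by rw [h.norm_J, one_mul]
  let T : H →L[ℂ] H := ContinuousLinearMap.id ℂ H + Jc ∘L P ∘L G
  have hTG (g : H) : T g = 𝓐 (e.symm g) - μ • (e.symm g : H) := by
    change g + J (P (G g)) = _
    rw [h.apply_eq, map_add, hG]
    conv_lhs => enter [1]; rw [← he g]
    abel
  have hlow : ∃ c, AntilipschitzWith c T := by
    refine ⟨Real.toNNReal (1 + ‖P‖ * C), AddMonoidHomClass.antilipschitz_of_bound T fun g => ?_⟩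
    have h1 : ‖(e.symm g : H)‖ ≤ C * ‖T g‖ := by rw [hTG]; exact hC _
    have h2 : g = T g - J (P (e.symm g : H)) := by
      change g = g + J (P (G g)) - _
      rw [hG]; abel
    have h3 : ‖g‖ ≤ ‖T g‖ + ‖P‖ * (C * ‖T g‖) := by
      calc ‖g‖ = ‖T g - J (P (e.symm g : H))‖ := by rw [← h2]
        _ ≤ ‖T g‖ + ‖J (P (e.symm g : H))‖ := norm_sub_le _ _
        _ ≤ ‖T g‖ + ‖P‖ * (C * ‖T g‖) := by
          rw [h.norm_J]
          exact add_le_add le_rfl ((P.le_opNorm _).trans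
            (mul_le_mul_of_nonneg_left h1 (norm_nonneg _)))
    refine h3.trans ?_
    rw [Real.coe_toNNReal']
    refine le_trans (le_of_eq (by ring)) (mul_le_mul_of_nonneg_right (le_max_left _ _)
      (norm_nonneg _))
  obtain ⟨c, hc⟩ := hlow
  have hclosed : IsClosed (LinearMap.range (T : H →ₗ[ℂ] H) : Set H) := by
    rw [LinearMap.coe_range]
    exact hc.isClosed_range T.uniformContinuous
  have hrange : LinearMap.range (T : H →ₗ[ℂ] H) = ⊤ := by
    have : CompleteSpace (LinearMap.range (T : H →ₗ[ℂ] H)) := hclosed.completeSpace_coe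
    rw [← Submodule.orthogonal_eq_bot_iff, Submodule.eq_bot_iff]
    intro ψ hψ
    have horth (x : 𝓐.domain) : ⟪ψ, 𝓐 x - μ • (x : H)⟫_ℂ = 0 := by
      rw [Submodule.mem_orthogonal'] at hψ
      have hx : e.symm (K₀ x) = x := e.symm_apply_apply x
      have := hψ (T (K₀ x)) ⟨_, rfl⟩
      rwa [hTG, hx] at this
    have hν : (-conj μ).re ≠ 0 := by simpa using hμ
    -- `ψ` solves the adjoint equation only weakly. Solving for `η` inside the domain makes `ψ + η`
    -- orthogonal to the range of J S - μ, which is everything. So ψ = -η lies in the domain, and `J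
    -- η` is in the kernel of 𝓐 + μ̄, where the lower bound applies again.
    obtain ⟨η, hη⟩ := hS (-conj μ) hν (P (J ψ))
    have hzero (x : 𝓐.domain) : ⟪ψ + η, J (S x) - μ • (x : H)⟫_ℂ = 0 := by
      have h1 : ⟪P (J ψ), (x : H)⟫_ℂ = ⟪ψ, J (S x) - μ • (x : H)⟫_ℂ := by
        have := horth x
        rw [h.apply_eq, map_add, add_sub_right_comm, inner_add_right] at this
        rw [h.P_symm, h.inner_J]
        linear_combination -this
      have h2 : ⟪P (J ψ), (x : H)⟫_ℂ = -⟪(η : H), J (S x) - μ • (x : H)⟫_ℂ := by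
        rw [← hη, inner_sub_left, inner_smul_left, inner_sub_right, inner_smul_right, h.inner_J,
          h.S_symm η ⟨J x, h.J_mem x x.2⟩, h.S_J]
        simp only [map_neg, Complex.conj_conj]
        ring
      rw [inner_add_left, ← h1, h2]; ring
    have hψη : ψ + η = 0 := by
      obtain ⟨x, hx⟩ := hS μ hμ (ψ + η)
      have := hzero x
      rwa [hx, inner_self_eq_zero] at this
    have hψ' : ψ = -(η : H) := eq_neg_of_add_eq_zero_left hψη
    obtain ⟨C', hC'⟩ := h.exists_norm_le hν
    have hker := hC' ⟨J η, h.J_mem η η.2⟩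
    have hz : 𝓐 ⟨J η, h.J_mem η η.2⟩ - (-conj μ) • J η = 0 := by
      rw [h.apply_eq, h.S_J, map_add, add_sub_right_comm, ← map_smul J, ← map_sub J, hη, hψ',
        map_neg J (η : H), map_neg P, map_neg J]
      simp
    rw [hz, norm_zero, mul_zero, h.norm_J, norm_le_zero_iff] at hker
    rw [hψ', hker, neg_zero]
  obtain ⟨g, hg⟩ : ∃ g, T g = f := by
    have : f ∈ LinearMap.range (T : H →ₗ[ℂ] H) := hrange ▸ Submodule.mem_top
    exact this
  exact ⟨e.symm g, by rw [← hTG, hg]⟩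

/-- A Hamiltonian operator with nonnegative energy has imaginary spectrum, provided its principal
part `J S` does. -/
theorem re_eq_zero_of_mem_spectrumOf (h : IsNonnegHamiltonian J 𝓐 S P)
    (hS : ∀ μ : ℂ, μ.re ≠ 0 → ∀ f : H, ∃ x : 𝓐.domain, J (S x) - μ • (x : H) = f)
    {μ : ℂ} (hμ : μ ∈ spectrumOf 𝓐) : μ.re = 0 := by
  by_contra hre
  refine hμ ?_
  obtain ⟨C, hC⟩ := h.exists_norm_le hre
  let K : 𝓐.domain →ₗ[ℂ] H := 𝓐.toFun - μ • 𝓐.domain.subtype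
  have hK (x : 𝓐.domain) : K x = 𝓐 x - μ • (x : H) := rfl
  have hbij : Function.Bijective K := by
    refine ⟨(injective_iff_map_eq_zero K).2 fun x hx => ?_, h.surjective_sub hS hre⟩
    have := hC x
    rw [← hK, hx, norm_zero, mul_zero] at this
    exact Subtype.ext (norm_le_zero_iff.1 this)
  let e := LinearEquiv.ofBijective K hbij
  have he (g : H) : 𝓐 (e.symm g) - μ • (e.symm g : H) = g := e.apply_symm_apply g
  refine ⟨(𝓐.domain.subtype ∘ₗ e.symm.toLinearMap).mkContinuous C fun g => ?_,
    fun f => ⟨(e.symm f).2, he f⟩, fun x => congrArg Subtype.val (e.symm_apply_apply x)⟩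
  have := hC (e.symm g)
  rwa [he] at this

end IsNonnegHamiltonian

end Hamiltonian

/-! ### The Fourier transform of the kernel -/

section Kernel

open scoped ComplexConjugate

lemma norm_exp_neg_I_mul (s x : ℝ) : ‖Complex.exp (-(Complex.I * s * x))‖ = 1 := by
  rw [Complex.norm_exp]; simp

lemma integrable_exp_mul {ρ : ℝ → ℝ} (hρ : Integrable ρ) (s : ℝ) :
    Integrable fun x : ℝ => Complex.exp (-(Complex.I * s * x)) * (ρ x : ℂ) :=
  (hρ.ofReal (𝕜 := ℂ)).bdd_mul (c := 1)
    (by fun_prop : Continuous fun x : ℝ => Complex.exp (-(Complex.I * s * x))).aestronglyMeasurable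
    (Filter.Eventually.of_forall fun x => (norm_exp_neg_I_mul s x).le)

lemma continuous_hat {ρ : ℝ → ℝ} (hρ : Integrable ρ) : Continuous (hat ρ) := by
  refine continuous_of_dominated (bound := fun x => ‖ρ x‖)
    (fun s => (integrable_exp_mul hρ s).aestronglyMeasurable)
    (fun s => Filter.Eventually.of_forall fun x => ?_) hρ.norm
    (Filter.Eventually.of_forall fun x => by fun_prop)
  rw [norm_mul, norm_exp_neg_I_mul, one_mul, Complex.norm_real]

lemma conj_hat {ρ : ℝ → ℝ} (he : ∀ x, ρ (-x) = ρ x) (s : ℝ) : conj (hat ρ s) = hat ρ s := by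
  unfold hat
  rw [← integral_conj, ← integral_neg_eq_self]
  refine integral_congr_ae (Filter.Eventually.of_forall fun x => ?_)
  simp only [map_mul, Complex.conj_ofReal, he, ← Complex.exp_conj]
  simp

lemma even_R {ζ : ℝ → ℝ} (he : ∀ x, ζ (-x) = ζ x) (ε x : ℝ) : R ζ ε (-x) = R ζ ε x := by
  simp only [R, neg_div, he]

lemma hat_R (ζ : ℝ → ℝ) {ε : ℝ} (hε : 0 < ε) (s : ℝ) : hat (R ζ ε) s = hat ζ (ε * s) := by
  have h := Measure.integral_comp_div
    (fun x : ℝ => Complex.exp (-(Complex.I * (ε * s : ℝ) * x)) * (ζ x : ℂ)) ε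
  unfold hat
  have h2 : (fun x : ℝ => Complex.exp (-(Complex.I * s * x)) * (R ζ ε x : ℂ)) = fun x : ℝ =>
      (ε⁻¹ : ℝ) • (Complex.exp (-(Complex.I * (ε * s : ℝ) * (x / ε : ℝ))) * (ζ (x / ε) : ℂ)) := by
    funext x
    have hε' : (ε : ℂ) ≠ 0 := by exact_mod_cast hε.ne'
    have e : Complex.I * (ε * s : ℝ) * (x / ε : ℝ) = Complex.I * s * x := by
      push_cast; field_simp
    rw [e, R, Complex.real_smul]
    push_cast
    ring
  rw [h2, integral_smul, h, smul_smul, abs_of_pos hε, inv_mul_cancel₀ hε.ne', one_smul]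

lemma hat_re {ρ : ℝ → ℝ} (hρ : Integrable ρ) (s : ℝ) :
    (hat ρ s).re = ∫ x, ρ x * Real.cos (s * x) := by
  have h := integral_re (integrable_exp_mul hρ s)
  simp only [RCLike.re_to_complex] at h
  rw [hat, ← h]
  refine integral_congr_ae (Filter.Eventually.of_forall fun x => ?_)
  have e : -(Complex.I * s * x) = ((-(s * x) : ℝ) : ℂ) * Complex.I := by push_cast; ring
  simp only [Complex.re_mul_ofReal, e, Complex.exp_ofReal_mul_I_re, Real.cos_neg]
  ring

lemma integral_mul_sin_eq_zero {ρ : ℝ → ℝ} (he : ∀ x, ρ (-x) = ρ x) (s : ℝ) :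
    ∫ x, ρ x * Real.sin (s * x) = 0 := by
  have h := integral_neg_eq_self (fun x : ℝ => ρ x * Real.sin (s * x)) volume
  simp only [he, mul_neg, Real.sin_neg, integral_neg] at h
  linarith

variable {ζ : ℝ → ℝ} {ε : ℝ}

lemma IsAdmissible.hat_R_re_pos (hζ : IsAdmissible ζ) (hε : 0 < ε) (s : ℝ) : 0 < (hat (R ζ ε) s).re := by
  rw [hat_R ζ hε]; exact hζ.hat_pos _

lemma IsAdmissible.β_pos (hζ : IsAdmissible ζ) (hε : 0 < ε) (k : ℝ) : 0 < β ζ k ε := by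
  have := hζ.hat_R_re_pos hε (2 * k)
  rwa [hat_re (integrable_R hζ.integrable ε)] at this

lemma IsAdmissible.integral_R (hζ : IsAdmissible ζ) (hε : 0 < ε) : ∫ x, R ζ ε x = 1 := by
  have h := Measure.integral_comp_div ζ ε
  simp only [R]
  rw [integral_const_mul, h, hζ.integral_eq_one, abs_of_pos hε]
  simp [hε.ne']

/-- The potential of the linearization is the constant `-k²/2`. -/
lemma IsAdmissible.totalPotential_eq (hζ : IsAdmissible ζ) (hε : 0 < ε) (k : ℝ)
    {B V₀ : ℝ} (hB : 0 ≤ B) (hV : V₀ ≤ 0) (x : ℝ) :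
    totalPotential ζ k ε B V₀ x = -(k ^ 2 / 2) := by
  have hβ := hζ.β_pos hε k
  have hRi := integrable_R hζ.integrable ε
  have hA : 0 ≤ A ζ k ε V₀ := div_nonneg (neg_nonneg.2 hV) hβ.le
  -- The density is a constant plus a multiple of cos(2kx), which convolution with the even kernel
  -- multiplies by β. Since Aβ = -V₀, the result cancels the oscillation of V.
  have hd (y : ℝ) : R ζ ε y * density ζ k ε B V₀ (x - y) =
      (B + A ζ k ε V₀ / 2) * R ζ ε y
      - A ζ k ε V₀ / 2 * Real.cos (2 * k * x) * (R ζ ε y * Real.cos (2 * k * y))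
      - A ζ k ε V₀ / 2 * Real.sin (2 * k * x) * (R ζ ε y * Real.sin (2 * k * y)) := by
    have h1 : density ζ k ε B V₀ (x - y) =
        B + A ζ k ε V₀ / 2 - A ζ k ε V₀ / 2 * Real.cos (2 * (k * (x - y))) := by
      simp only [density, waveRe, waveIm, mul_pow, Real.sq_sqrt hB,
        Real.sq_sqrt (add_nonneg hB hA), Real.cos_two_mul]
      have := Real.sin_sq_add_cos_sq (k * (x - y))
      linear_combination (B + A ζ k ε V₀) * this
    have h2 : 2 * (k * (x - y)) = 2 * k * x - 2 * k * y := by ring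
    rw [h1, h2, Real.cos_sub]
    ring
  have hcos : Integrable fun y => R ζ ε y * Real.cos (2 * k * y) :=
    hRi.mul_bdd (c := 1)
      (by fun_prop : Continuous fun y : ℝ => Real.cos (2 * k * y)).aestronglyMeasurable
      (Filter.Eventually.of_forall fun y => Real.abs_cos_le_one _)
  have hsin : Integrable fun y => R ζ ε y * Real.sin (2 * k * y) :=
    hRi.mul_bdd (c := 1)
      (by fun_prop : Continuous fun y : ℝ => Real.sin (2 * k * y)).aestronglyMeasurable
      (Filter.Eventually.of_forall fun y => Real.abs_sin_le_one _)
  have hint : ∫ y, R ζ ε y * density ζ k ε B V₀ (x - y) =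
      B + A ζ k ε V₀ / 2 - A ζ k ε V₀ / 2 * Real.cos (2 * k * x) * β ζ k ε := by
    simp only [hd]
    rw [integral_sub (f := fun y => (B + A ζ k ε V₀ / 2) * R ζ ε y -
        A ζ k ε V₀ / 2 * Real.cos (2 * k * x) * (R ζ ε y * Real.cos (2 * k * y)))
        ((hRi.const_mul _).sub (hcos.const_mul _)) (hsin.const_mul _),
      integral_sub (hRi.const_mul _) (hcos.const_mul _), integral_const_mul, integral_const_mul,
      integral_const_mul, integral_mul_sin_eq_zero (even_R hζ.even ε), hζ.integral_R hε, β]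
    ring
  have hc : Real.cos (2 * k * x) = 1 - 2 * Real.sin (k * x) ^ 2 := by
    rw [mul_assoc, Real.cos_two_mul, Real.cos_sq']; ring
  rw [totalPotential, hint, V, ω, A, hc]
  field_simp
  ring

/-- On bounded sets of frequencies the kernel has a positive lower bound. -/
lemma IsAdmissible.exists_le_hat_R (hζ : IsAdmissible ζ) (hε : 0 < ε) (r : ℝ) :
    ∃ m > 0, ∀ s : ℝ, |s| ≤ r → m ≤ (hat (R ζ ε) s).re := by
  rcases lt_or_ge r 0 with hr | hr
  · exact ⟨1, one_pos, fun s hs => absurd (abs_nonneg s) (by linarith)⟩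
  obtain ⟨s₀, -, hs₀⟩ := (isCompact_Icc (a := -r) (b := r)).exists_isMinOn
    ⟨0, by simpa using hr⟩
    (Complex.continuous_re.comp (continuous_hat (integrable_R hζ.integrable ε))).continuousOn
  exact ⟨_, hζ.hat_R_re_pos hε s₀, fun s hs => hs₀ (abs_le.1 hs)⟩

end Kernel

/-! ### Fourier coefficients on the circle -/

section CircleFourier

open scoped InnerProductSpace ComplexConjugate

variable {T : ℝ}

variable (T) in
/-- The frequency `2πj/T` of the `j`-th Fourier mode. -/
def freq (j : ℤ) : ℝ := 2 * π * j / T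

lemma freq_sq (j : ℤ) : 4 * π ^ 2 * (j : ℝ) ^ 2 / T ^ 2 = freq T j ^ 2 := by
  rw [freq, div_pow]; ring

lemma fourier_coe_eq_exp (j : ℤ) (x : ℝ) :
    fourier j (x : AddCircle T) = Complex.exp (Complex.I * freq T j * x) := by
  rw [fourier_coe_apply, freq]
  congr 1
  push_cast
  ring

variable [hT : Fact (0 < T)]

lemma mem_H2_iff (f : L2 T) :
    f ∈ H2 T ↔ Summable fun j : ℤ => (1 + freq T j ^ 2) ^ 2 * ‖fourierBasis.repr f j‖ ^ 2 := by
  simp only [← freq_sq, fourierBasis_repr]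
  rfl

lemma hasSum_inner_repr (f g : L2 T) :
    HasSum (fun j : ℤ => conj (fourierBasis.repr f j) * fourierBasis.repr g j) ⟪f, g⟫_ℂ := by
  have h := lp.hasSum_inner (𝕜 := ℂ) (G := fun _ : ℤ => ℂ) (fourierBasis.repr f) (fourierBasis.repr g)
  rw [LinearIsometryEquiv.inner_map_map] at h
  refine h.congr_fun fun j => ?_
  rw [RCLike.inner_apply, mul_comm]

lemma ext_repr {f g : L2 T} (h : ∀ j, fourierBasis.repr f j = fourierBasis.repr g j) : f = g :=
  fourierBasis.repr.injective (lp.ext (funext h))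

/-- Symmetry of real Fourier multipliers, phrased through coefficients so that it covers both the
unbounded local part and convolution. -/
lemma inner_eq_of_repr {M f g : L2 T} {m : ℤ → ℝ} {N : L2 T}
    (hf : ∀ j, fourierBasis.repr M j = m j * fourierBasis.repr f j)
    (hg : ∀ j, fourierBasis.repr N j = m j * fourierBasis.repr g j) : ⟪M, g⟫_ℂ = ⟪f, N⟫_ℂ := by
  refine (hasSum_inner_repr M g).unique ((hasSum_inner_repr f N).congr_fun fun j => ?_)
  rw [hf, hg, map_mul, Complex.conj_ofReal]
  ring

lemma hasSum_re_inner_of_repr {M f : L2 T} {m : ℤ → ℝ}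
    (hf : ∀ j, fourierBasis.repr M j = m j * fourierBasis.repr f j) :
    HasSum (fun j => m j * ‖fourierBasis.repr f j‖ ^ 2) (⟪f, M⟫_ℂ).re := by
  refine (Complex.hasSum_re (hasSum_inner_repr f M)).congr_fun fun j => ?_
  rw [hf, mul_left_comm, Complex.re_ofReal_mul, Complex.conj_mul', ← Complex.ofReal_pow,
    Complex.ofReal_re]

/-! ### Multiplication operators -/

section MulOp

variable {g : ℝ → ℝ} (hg : Continuous g) (hp : Function.Periodic g T)

lemma coeFn_mulOp (f : L2 T) :
    mulOp g hg hp f =ᵐ[haarAddCircle] fun x => (hp.lift x : ℂ) * f x := by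
  simp only [mulOp, LinearMap.coe_mk, AddHom.coe_mk]
  exact MemLp.coeFn_toLp _

lemma mulOp_symm (f₁ f₂ : L2 T) : ⟪mulOp g hg hp f₁, f₂⟫_ℂ = ⟪f₁, mulOp g hg hp f₂⟫_ℂ := by
  rw [L2.inner_def, L2.inner_def]
  refine integral_congr_ae ?_
  filter_upwards [coeFn_mulOp hg hp f₁, coeFn_mulOp hg hp f₂] with x h₁ h₂
  simp only [h₁, h₂, RCLike.inner_apply, map_mul, Complex.conj_ofReal]
  ring

/-- Hellinger–Toeplitz: a symmetric operator defined on the whole Hilbert space is bounded. -/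
lemma continuous_mulOp : Continuous (mulOp g hg hp) :=
  LinearMap.IsSymmetric.continuous (T := mulOp g hg hp) (mulOp_symm hg hp)

lemma mulOp_of_eq_const {c : ℝ} (hc : ∀ x, g x = c) (f : L2 T) :
    mulOp g hg hp f = (c : ℂ) • f := by
  refine Lp.ext ?_
  filter_upwards [coeFn_mulOp hg hp f, Lp.coeFn_smul (c : ℂ) f] with x h₁ h₂
  induction x using QuotientAddGroup.induction_on with
  | H x => rw [h₁, h₂, Pi.smul_apply, smul_eq_mul, hp.lift_coe, hc]

end MulOp

/-! ### Convolution operators -/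

lemma repr_translate (y : ℝ) (f : L2 T) (j : ℤ) :
    fourierBasis.repr (translate y f) j =
      Complex.exp (-(Complex.I * freq T j * y)) * fourierBasis.repr f j := by
  rw [fourierBasis_repr, fourierBasis_repr]
  have h1 : translate y f =ᵐ[haarAddCircle] fun x => f (x - (y : AddCircle T)) :=
    Lp.coeFn_compMeasurePreserving f (measurePreserving_sub_right haarAddCircle (y : AddCircle T))
  rw [fourierCoeff_congr_ae h1]
  unfold fourierCoeff
  have h2 := integral_sub_right_eq_self (μ := haarAddCircle)
    (fun t : AddCircle T => fourier (-j) (t + (y : AddCircle T)) • f t) (y : AddCircle T)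
  simp only [sub_add_cancel] at h2
  rw [h2, ← integral_const_mul]
  refine integral_congr_ae (Filter.Eventually.of_forall fun t => ?_)
  have h3 : fourier (-j) (t + (y : AddCircle T)) =
      fourier (-j) t * fourier (-j) (y : AddCircle T) := by
    simp only [fourier_apply, smul_add, toCircle_add, Circle.coe_mul]
  have h4 : freq T (-j) = -freq T j := by simp [freq, neg_div]
  simp only [h3, smul_eq_mul, fourier_coe_eq_exp, h4]
  push_cast
  ring_nf

lemma repr_convOp {ρ : ℝ → ℝ} (hρ : Integrable ρ) (f : L2 T) (j : ℤ) :
    fourierBasis.repr (convOp ρ hρ f) j = hat ρ (freq T j) * fourierBasis.repr f j := by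
  have hi : Integrable fun y : ℝ => (ρ y : ℂ) • translate y f :=
    (hρ.ofReal (𝕜 := ℂ)).smul_bdd ‖f‖ (continuous_translate f).aestronglyMeasurable
      (Filter.Eventually.of_forall fun y => ((translate y).norm_map f).le)
  rw [HilbertBasis.repr_apply_apply]
  change ⟪_, ∫ y : ℝ, (ρ y : ℂ) • translate y f⟫_ℂ = _
  rw [← integral_inner hi, hat, ← integral_mul_const]
  refine integral_congr_ae (Filter.Eventually.of_forall fun y => ?_)
  simp only [inner_smul_right, ← HilbertBasis.repr_apply_apply, repr_translate]
  ring

lemma repr_convOp_of_even {ρ : ℝ → ℝ} (hρ : Integrable ρ) (he : ∀ x, ρ (-x) = ρ x) (f : L2 T)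
    (j : ℤ) : fourierBasis.repr (convOp ρ hρ f) j =
      ((hat ρ (freq T j)).re : ℂ) * fourierBasis.repr f j := by
  rw [repr_convOp, (Complex.conj_eq_iff_re.1 (conj_hat he _))]

lemma convOp_symm {ρ : ℝ → ℝ} (hρ : Integrable ρ) (he : ∀ x, ρ (-x) = ρ x) (f₁ f₂ : L2 T) :
    ⟪convOp ρ hρ f₁, f₂⟫_ℂ = ⟪f₁, convOp ρ hρ f₂⟫_ℂ :=
  inner_eq_of_repr (repr_convOp_of_even hρ he f₁) (repr_convOp_of_even hρ he f₂)

lemma continuous_convOp {ρ : ℝ → ℝ} (hρ : Integrable ρ) (he : ∀ x, ρ (-x) = ρ x) :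
    Continuous (convOp (T := T) ρ hρ) :=
  LinearMap.IsSymmetric.continuous (T := convOp ρ hρ) (convOp_symm hρ he)

/-! ### Fourier multipliers of second order -/

lemma repr_secondDeriv (f : H2 T) (j : ℤ) :
    fourierBasis.repr (secondDeriv f) j = -(freq T j ^ 2 : ℝ) * fourierBasis.repr (f : L2 T) j := by
  simp only [secondDeriv, LinearMap.coe_mk, AddHom.coe_mk, LinearIsometryEquiv.apply_symm_apply,
    freq_sq]

/-- If `S` acts on Fourier coefficients by `(freq² - k²)/2`, then `S - ν` maps `H2` onto `L2` for
every nonreal `ν`. -/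
lemma surjective_sub_of_repr {S : H2 T →ₗ[ℂ] L2 T} {k : ℝ}
    (hS : ∀ f j, fourierBasis.repr (S f) j =
      (((freq T j ^ 2 - k ^ 2) / 2 : ℝ) : ℂ) * fourierBasis.repr (f : L2 T) j)
    {ν : ℂ} (hν : ν.im ≠ 0) (f : L2 T) : ∃ w : H2 T, S w - ν • (w : L2 T) = f := by
  set s : ℤ → ℝ := fun j => (freq T j ^ 2 - k ^ 2) / 2 with hs
  have hpos : 0 < |ν.im| := abs_pos.2 hν
  have him (j : ℤ) : |ν.im| ≤ ‖(s j : ℂ) - ν‖ := by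
    have := Complex.abs_im_le_norm ((s j : ℂ) - ν)
    simpa using this
  have hne (j : ℤ) : (s j : ℂ) - ν ≠ 0 := norm_pos_iff.1 (hpos.trans_le (him j))
  -- Here 1 + freq² ≤ (k² + 2)(1 + |s|) and |s| ≤ |s - ν| + |ν|; the leftover 1 + |ν| is absorbed
  -- using |Im ν| ≤ |s - ν|. This bound is what places the solution in `H2`.
  set C := (k ^ 2 + 2) * (1 + (1 + ‖ν‖) / |ν.im|) with hC
  have hC0 : 0 ≤ C := by positivity
  have hbound (j : ℤ) : 1 + freq T j ^ 2 ≤ C * ‖(s j : ℂ) - ν‖ := by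
    have h1 : |s j| ≤ ‖(s j : ℂ) - ν‖ + ‖ν‖ := by
      have := norm_add_le ((s j : ℂ) - ν) ν
      rwa [sub_add_cancel, Complex.norm_real, Real.norm_eq_abs] at this
    have h2 : 1 + ‖ν‖ ≤ (1 + ‖ν‖) / |ν.im| * ‖(s j : ℂ) - ν‖ := by
      rw [div_mul_eq_mul_div, le_div_iff₀ hpos]
      exact mul_le_mul_of_nonneg_left (him j) (by positivity)
    have h3 : 1 + freq T j ^ 2 ≤ (k ^ 2 + 2) * (1 + |s j|) := by
      have h4 : freq T j ^ 2 = 2 * s j + k ^ 2 := by simp only [hs]; ring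
      have := le_abs_self (s j)
      nlinarith [sq_nonneg k, abs_nonneg (s j), mul_nonneg (sq_nonneg k) (abs_nonneg (s j))]
    refine h3.trans ?_
    rw [hC, mul_assoc]
    refine mul_le_mul_of_nonneg_left ?_ (by positivity)
    rw [add_mul, one_mul]
    linarith
  have hsq : Summable fun j : ℤ => ‖fourierBasis.repr f j‖ ^ 2 := by
    simpa only [fourierBasis_repr] using (hasSum_sq_fourierCoeff f).summable
  have hkey (j : ℤ) : (1 + freq T j ^ 2) ^ 2 * ‖((s j : ℂ) - ν)⁻¹ * fourierBasis.repr f j‖ ^ 2 ≤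
      C ^ 2 * ‖fourierBasis.repr f j‖ ^ 2 := by
    rw [← mul_pow, ← mul_pow, norm_mul, norm_inv]
    refine pow_le_pow_left₀ (by positivity) ?_ 2
    rw [← mul_assoc, ← div_eq_mul_inv]
    refine mul_le_mul_of_nonneg_right ?_ (norm_nonneg _)
    rw [div_le_iff₀ (norm_pos_iff.2 (hne j))]
    exact hbound j
  have hmem : Memℓp (fun j : ℤ => ((s j : ℂ) - ν)⁻¹ * fourierBasis.repr f j) 2 := by
    refine memℓp_gen (Summable.of_nonneg_of_le (fun j => by positivity) (fun j => ?_)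
      (hsq.mul_left (C ^ 2)))
    refine le_trans ?_ (hkey j)
    simp only [ENNReal.toReal_ofNat, Real.rpow_ofNat]
    refine le_mul_of_one_le_left (by positivity) (one_le_pow₀ ?_)
    nlinarith [sq_nonneg (freq T j)]
  have hw : fourierBasis.repr.symm ⟨_, hmem⟩ ∈ H2 T := by
    rw [mem_H2_iff, LinearIsometryEquiv.apply_symm_apply]
    exact Summable.of_nonneg_of_le (fun j => by positivity) hkey (hsq.mul_left (C ^ 2))
  refine ⟨⟨_, hw⟩, ext_repr fun j => ?_⟩
  rw [map_sub, map_smul, lp.coeFn_sub, Pi.sub_apply, lp.coeFn_smul, Pi.smul_apply, hS,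
    LinearIsometryEquiv.apply_symm_apply, smul_eq_mul, ← sub_mul]
  change ((s j : ℂ) - ν) * (((s j : ℂ) - ν)⁻¹ * _) = _
  rw [mul_inv_cancel_left₀ (hne j)]

end CircleFourier

/-! ### Coercivity of the energy in the density variable -/

section Coercivity

/-- In the moving frame `w = u p - v q`, `z = v p + u q` of a curve `(u, v)` with
`u'' = -k² u`, `v'' = -k² v`, the energy density is, up to a total derivative,
`ρ (p'² + q'²) + 4 J₀ p q'` with `J₀ = u v' - v u'`. Here everything is evaluated at a point, and
the subscript `1` marks first derivatives. -/
lemma energy_density_ge {B k u v u₁ v₁ p q p₁ q₁ : ℝ} (hB : 0 < B)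
    (hl : B ≤ u ^ 2 + v ^ 2) (hu : u ^ 2 + v ^ 2 ≤ 2 * B)
    (hd : (2 * (u * u₁ + v * v₁)) ^ 2 ≤ (B * k) ^ 2)
    (hJ : (u * v₁ - v * u₁) ^ 2 ≤ 2 * (k * B) ^ 2) :
    ((u ^ 2 + v ^ 2) * p₁ + 2 * (u * u₁ + v * v₁) * p) ^ 2 / (4 * B) -
        9 * k ^ 2 / B * ((u ^ 2 + v ^ 2) * p) ^ 2 ≤
      (u₁ * p + u * p₁ - (v₁ * q + v * q₁)) ^ 2 + (v₁ * p + v * p₁ + (u₁ * q + u * q₁)) ^ 2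
        - k ^ 2 * ((u * p - v * q) ^ 2 + (v * p + u * q) ^ 2)
        - ((u₁ ^ 2 + v₁ ^ 2 - k ^ 2 * (u ^ 2 + v ^ 2)) * (p ^ 2 + q ^ 2)
          + (u * u₁ + v * v₁) * (2 * p * p₁ + 2 * q * q₁)
          - 2 * (u * v₁ - v * u₁) * (p₁ * q + p * q₁)) := by
  set ρ := u ^ 2 + v ^ 2 with hρ
  set ρ₁ := 2 * (u * u₁ + v * v₁) with hρ₁
  set j := u * v₁ - v * u₁ with hj
  have hρ0 : 0 < ρ := hB.trans_le hl
  have e : (u₁ * p + u * p₁ - (v₁ * q + v * q₁)) ^ 2 + (v₁ * p + v * p₁ + (u₁ * q + u * q₁)) ^ 2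
        - k ^ 2 * ((u * p - v * q) ^ 2 + (v * p + u * q) ^ 2)
        - ((u₁ ^ 2 + v₁ ^ 2 - k ^ 2 * ρ) * (p ^ 2 + q ^ 2)
          + (u * u₁ + v * v₁) * (2 * p * p₁ + 2 * q * q₁) - 2 * j * (p₁ * q + p * q₁)) =
      ρ * p₁ ^ 2 + (ρ * q₁ ^ 2 + 4 * j * (p * q₁)) := by
    rw [hρ, hj]; ring
  rw [e]
  have hf : B ^ 2 * p ^ 2 ≤ (ρ * p) ^ 2 := by
    rw [mul_pow]; gcongr
  -- Completing the square in `q₁` costs 4j²p²/ρ, at most 8k²Bp².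
  have h1 : -(8 * k ^ 2 * B * p ^ 2) ≤ ρ * q₁ ^ 2 + 4 * j * (p * q₁) := by
    have h2 : 0 ≤ ρ * (ρ * q₁ ^ 2 + 4 * j * (p * q₁) + 8 * k ^ 2 * B * p ^ 2) := by
      have h3 : 4 * j ^ 2 * p ^ 2 ≤ ρ * (8 * k ^ 2 * B * p ^ 2) := by
        have h4 : B * (8 * k ^ 2 * B * p ^ 2) ≤ ρ * (8 * k ^ 2 * B * p ^ 2) := by gcongr
        have h5 : 4 * j ^ 2 * p ^ 2 ≤ 4 * (2 * (k * B) ^ 2) * p ^ 2 := by gcongr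
        linarith
      nlinarith [sq_nonneg (ρ * q₁ + 2 * j * p)]
    have := nonneg_of_mul_nonneg_right h2 hρ0
    linarith
  -- Trading p' for f' = ρp' + ρ'p costs a further k²Bp²/2. The total 8 + 1/2 is rounded up to 9.
  have h2 : (ρ * p₁ + ρ₁ * p) ^ 2 ≤ 4 * B * (ρ * p₁ ^ 2) + 2 * (B * k) ^ 2 * p ^ 2 := by
    have h3 : ρ * (ρ * p₁ ^ 2) ≤ 2 * B * (ρ * p₁ ^ 2) := by gcongr
    have h4 : ρ₁ ^ 2 * p ^ 2 ≤ (B * k) ^ 2 * p ^ 2 := by gcongr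
    nlinarith [sq_nonneg (ρ * p₁ - ρ₁ * p)]
  have h3 : (ρ * p₁ + ρ₁ * p) ^ 2 / (4 * B) ≤ ρ * p₁ ^ 2 + k ^ 2 * B * p ^ 2 / 2 := by
    rw [div_le_iff₀ (by positivity)]
    linarith
  have h4 : 9 * k ^ 2 * B * p ^ 2 ≤ 9 * k ^ 2 / B * (ρ * p) ^ 2 := by
    have := mul_le_mul_of_nonneg_left hf (show 0 ≤ 9 * k ^ 2 / B by positivity)
    refine le_trans (le_of_eq ?_) this
    field_simp
  have h5 : 0 ≤ k ^ 2 * B * p ^ 2 := by positivity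
  linarith

variable {B A k T : ℝ} {u v : ℝ → ℝ}

/-- The integrated lower bound, for real perturbations. -/
lemma integral_energy_ge_real (hB : 0 < B) (hA : 0 ≤ A) (hAB : A ≤ B) (hT : 0 ≤ T)
    (hu : ∀ x, u x = √B * Real.cos (k * x)) (hv : ∀ x, v x = √(B + A) * Real.sin (k * x))
    (hup : Function.Periodic u T) (hvp : Function.Periodic v T)
    {u₁ v₁ w z w₁ z₁ : ℝ → ℝ} (hud : ∀ x, HasDerivAt u (u₁ x) x) (hvd : ∀ x, HasDerivAt v (v₁ x) x)
    (hw : ∀ x, HasDerivAt w (w₁ x) x) (hz : ∀ x, HasDerivAt z (z₁ x) x)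
    (hwc : Continuous w₁) (hzc : Continuous z₁)
    (hwp : Function.Periodic w T) (hzp : Function.Periodic z T) :
    ∫ x in (0 : ℝ)..T, ((u₁ x * w x + u x * w₁ x + (v₁ x * z x + v x * z₁ x)) ^ 2 / (4 * B) -
        9 * k ^ 2 / B * (u x * w x + v x * z x) ^ 2) ≤
      ∫ x in (0 : ℝ)..T, (w₁ x ^ 2 + z₁ x ^ 2 - k ^ 2 * (w x ^ 2 + z x ^ 2)) := by
  have hk (x : ℝ) : HasDerivAt (fun x => k * x) k x := by
    simpa using (hasDerivAt_id x).const_mul k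
  have hu₁ (x : ℝ) : u₁ x = -(k * (√B * Real.sin (k * x))) := by
    have h := ((hk x).cos.const_mul √B)
    rw [← funext hu] at h
    rw [(hud x).unique h]; ring
  have hv₁ (x : ℝ) : v₁ x = k * (√(B + A) * Real.cos (k * x)) := by
    have h := ((hk x).sin.const_mul √(B + A))
    rw [← funext hv] at h
    rw [(hvd x).unique h]; ring
  have hu₂ (x : ℝ) : HasDerivAt u₁ (-(k ^ 2 * u x)) x := by
    have h := (((hk x).sin.const_mul √B).const_mul k).neg
    have e : u₁ = -fun x => k * (√B * Real.sin (k * x)) := funext hu₁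
    rw [e]
    refine HasDerivAt.congr_deriv h ?_
    rw [hu]; ring
  have hv₂ (x : ℝ) : HasDerivAt v₁ (-(k ^ 2 * v x)) x := by
    have h := (((hk x).cos.const_mul √(B + A)).const_mul k)
    have e : v₁ = fun x => k * (√(B + A) * Real.cos (k * x)) := funext hv₁
    rw [e]
    refine HasDerivAt.congr_deriv h ?_
    rw [hv]; ring
  have sB : √B ^ 2 = B := Real.sq_sqrt hB.le
  have sA : √(B + A) ^ 2 = B + A := Real.sq_sqrt (by linarith)
  have hρ (x : ℝ) : u x ^ 2 + v x ^ 2 = B + A * Real.sin (k * x) ^ 2 := by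
    rw [hu, hv, mul_pow, mul_pow, sB, sA, Real.cos_sq']; ring
  have hρl (x : ℝ) : B ≤ u x ^ 2 + v x ^ 2 := by
    rw [hρ]; nlinarith [sq_nonneg (Real.sin (k * x))]
  have hρu (x : ℝ) : u x ^ 2 + v x ^ 2 ≤ 2 * B := by
    rw [hρ]; nlinarith [Real.sin_sq_le_one (k * x)]
  have hρd (x : ℝ) : (2 * (u x * u₁ x + v x * v₁ x)) ^ 2 ≤ (B * k) ^ 2 := by
    have e : 2 * (u x * u₁ x + v x * v₁ x) = A * k * Real.sin (2 * (k * x)) := by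
      rw [hu, hv, hu₁, hv₁, Real.sin_two_mul]
      linear_combination 2 * k * Real.sin (k * x) * Real.cos (k * x) * (sA - sB)
    rw [e, mul_pow, mul_pow, mul_pow]
    calc A ^ 2 * k ^ 2 * Real.sin (2 * (k * x)) ^ 2 ≤ A ^ 2 * k ^ 2 * 1 := by
          gcongr; exact Real.sin_sq_le_one _
      _ ≤ B ^ 2 * k ^ 2 := by rw [mul_one]; gcongr
  have hJ (x : ℝ) : (u x * v₁ x - v x * u₁ x) ^ 2 ≤ 2 * (k * B) ^ 2 := by
    have e : u x * v₁ x - v x * u₁ x = k * (√B * √(B + A)) := by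
      rw [hu, hv, hu₁, hv₁]
      linear_combination k * √B * √(B + A) * Real.sin_sq_add_cos_sq (k * x)
    rw [e, mul_pow, mul_pow, sB, sA, mul_pow]
    have : k ^ 2 * (B * A) ≤ k ^ 2 * (B * B) := by gcongr
    nlinarith
  have hρ0 (x : ℝ) : u x ^ 2 + v x ^ 2 ≠ 0 := (hB.trans_le (hρl x)).ne'
  -- the moving frame
  set p : ℝ → ℝ := fun x => (u x * w x + v x * z x) / (u x ^ 2 + v x ^ 2) with hp
  set q : ℝ → ℝ := fun x => (u x * z x - v x * w x) / (u x ^ 2 + v x ^ 2) with hq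
  have hρd' (x : ℝ) : HasDerivAt (fun x => u x ^ 2 + v x ^ 2) (2 * (u x * u₁ x + v x * v₁ x)) x := by
    refine HasDerivAt.congr_deriv (((hud x).pow 2).add ((hvd x).pow 2)) ?_
    ring
  have hpd (x : ℝ) := (((hud x).mul (hw x)).add ((hvd x).mul (hz x))).div (hρd' x) (hρ0 x)
  have hqd (x : ℝ) := (((hud x).mul (hz x)).sub ((hvd x).mul (hw x))).div (hρd' x) (hρ0 x)
  set p₁ : ℝ → ℝ := fun x => ((u₁ x * w x + u x * w₁ x + (v₁ x * z x + v x * z₁ x)) *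
    (u x ^ 2 + v x ^ 2) - (u x * w x + v x * z x) * (2 * (u x * u₁ x + v x * v₁ x))) /
      (u x ^ 2 + v x ^ 2) ^ 2 with hp₁
  set q₁ : ℝ → ℝ := fun x => ((u₁ x * z x + u x * z₁ x - (v₁ x * w x + v x * w₁ x)) *
    (u x ^ 2 + v x ^ 2) - (u x * z x - v x * w x) * (2 * (u x * u₁ x + v x * v₁ x))) /
      (u x ^ 2 + v x ^ 2) ^ 2 with hq₁
  replace hpd (x : ℝ) : HasDerivAt p (p₁ x) x := hpd x
  replace hqd (x : ℝ) : HasDerivAt q (q₁ x) x := hqd x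
  have hwe : w = fun x => u x * p x - v x * q x := by
    funext x
    have := hρ0 x
    simp only [hp, hq]; field_simp; ring
  have hze : z = fun x => v x * p x + u x * q x := by
    funext x
    have := hρ0 x
    simp only [hp, hq]; field_simp; ring
  have hw₁ (x : ℝ) : w₁ x = u₁ x * p x + u x * p₁ x - (v₁ x * q x + v x * q₁ x) := by
    refine (hw x).unique ?_
    rw [hwe]
    exact ((hud x).mul (hpd x)).sub ((hvd x).mul (hqd x))
  have hz₁ (x : ℝ) : z₁ x = v₁ x * p x + v x * p₁ x + (u₁ x * q x + u x * q₁ x) := by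
    refine (hz x).unique ?_
    rw [hze]
    exact ((hvd x).mul (hpd x)).add ((hud x).mul (hqd x))
  -- the total derivative
  set E : ℝ → ℝ := fun x => (u x * u₁ x + v x * v₁ x) * (p x ^ 2 + q x ^ 2) -
    2 * (u x * v₁ x - v x * u₁ x) * (p x * q x) with hE
  set E₁ : ℝ → ℝ := fun x => (u₁ x ^ 2 + v₁ x ^ 2 - k ^ 2 * (u x ^ 2 + v x ^ 2)) *
      (p x ^ 2 + q x ^ 2) + (u x * u₁ x + v x * v₁ x) * (2 * p x * p₁ x + 2 * q x * q₁ x) -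
      2 * (u x * v₁ x - v x * u₁ x) * (p₁ x * q x + p x * q₁ x) with hE₁
  have hEd (x : ℝ) : HasDerivAt E (E₁ x) x := by
    refine HasDerivAt.congr_deriv (((((hud x).mul (hu₂ x)).add ((hvd x).mul (hv₂ x))).mul
      (((hpd x).pow 2).add ((hqd x).pow 2))).sub
        (((((hud x).mul (hv₂ x)).sub ((hvd x).mul (hu₂ x))).const_mul 2).mul
          ((hpd x).mul (hqd x)))) ?_
    simp only [hE₁, Pi.mul_apply, Pi.add_apply, Pi.sub_apply, Pi.pow_apply]
    ring
  have hcont {f f' : ℝ → ℝ} (h : ∀ x, HasDerivAt f (f' x) x) : Continuous f :=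
    continuous_iff_continuousAt.2 fun x => (h x).continuousAt
  have cu := hcont hud
  have cv := hcont hvd
  have cu₁ := hcont hu₂
  have cv₁ := hcont hv₂
  have cw := hcont hw
  have cz := hcont hz
  have cp := hcont hpd
  have cq := hcont hqd
  have cp₁ : Continuous p₁ := by
    refine Continuous.div (by fun_prop) (by fun_prop) fun x => pow_ne_zero _ (hρ0 x)
  have cq₁ : Continuous q₁ := by
    refine Continuous.div (by fun_prop) (by fun_prop) fun x => pow_ne_zero _ (hρ0 x)
  have cE₁ : Continuous E₁ := by fun_prop
  -- `E` takes the same value at both ends of a period. For `u₁` and `v₁` this follows from the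
  -- periodicity of `u`, `v` and uniqueness of derivatives.
  have hE0 : ∫ x in (0 : ℝ)..T, E₁ x = 0 := by
    rw [intervalIntegral.integral_eq_sub_of_hasDerivAt (fun x _ => hEd x)
      (cE₁.intervalIntegrable _ _), sub_eq_zero]
    have hu₁p : u₁ T = u₁ 0 := by
      have h := (hud (0 + T)).comp_add_const 0 T
      rw [zero_add, funext hup] at h
      exact h.unique (hud 0)
    have hv₁p : v₁ T = v₁ 0 := by
      have h := (hvd (0 + T)).comp_add_const 0 T
      rw [zero_add, funext hvp] at h
      exact h.unique (hvd 0)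
    simp only [hE, hp, hq, hu₁p, hv₁p, hup.eq, hvp.eq, hwp.eq, hzp.eq]
  have key : ∫ x in (0 : ℝ)..T, ((u₁ x * w x + u x * w₁ x + (v₁ x * z x + v x * z₁ x)) ^ 2 / (4 * B)
        - 9 * k ^ 2 / B * (u x * w x + v x * z x) ^ 2) ≤
      ∫ x in (0 : ℝ)..T, ((w₁ x ^ 2 + z₁ x ^ 2 - k ^ 2 * (w x ^ 2 + z x ^ 2)) - E₁ x) := by
    refine intervalIntegral.integral_mono hT
      (Continuous.intervalIntegrable (by fun_prop) _ _)
      (Continuous.intervalIntegrable (by fun_prop) _ _) fun x => ?_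
    have h := energy_density_ge (p := p x) (q := q x) (p₁ := p₁ x) (q₁ := q₁ x) hB (hρl x) (hρu x)
      (hρd x) (hJ x)
    have e1 : (u x ^ 2 + v x ^ 2) * p x = u x * w x + v x * z x :=
      mul_div_cancel₀ _ (hρ0 x)
    have e2 : (u x ^ 2 + v x ^ 2) * p₁ x + 2 * (u x * u₁ x + v x * v₁ x) * p x =
        u₁ x * w x + u x * w₁ x + (v₁ x * z x + v x * z₁ x) := by
      have h1 := congrFun hwe x
      have h2 := congrFun hze x
      rw [hw₁, hz₁, h1, h2]
      ring
    rw [e1, e2, ← hw₁, ← hz₁, ← congrFun hwe x, ← congrFun hze x] at h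
    exact h
  rwa [intervalIntegral.integral_sub (Continuous.intervalIntegrable (by fun_prop) _ _)
    (cE₁.intervalIntegrable _ _), hE0, sub_zero] at key

/-- The integrated lower bound, for complex perturbations. -/
lemma integral_energy_ge (hB : 0 < B) (hA : 0 ≤ A) (hAB : A ≤ B) (hT : 0 ≤ T)
    (hu : ∀ x, u x = √B * Real.cos (k * x)) (hv : ∀ x, v x = √(B + A) * Real.sin (k * x))
    (hup : Function.Periodic u T) (hvp : Function.Periodic v T)
    {u₁ v₁ : ℝ → ℝ} {w z w₁ z₁ : ℝ → ℂ}
    (hud : ∀ x, HasDerivAt u (u₁ x) x) (hvd : ∀ x, HasDerivAt v (v₁ x) x)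
    (hu₁c : Continuous u₁) (hv₁c : Continuous v₁)
    (hw : ∀ x, HasDerivAt w (w₁ x) x) (hz : ∀ x, HasDerivAt z (z₁ x) x)
    (hwc : Continuous w₁) (hzc : Continuous z₁)
    (hwp : Function.Periodic w T) (hzp : Function.Periodic z T) :
    ∫ x in (0 : ℝ)..T, (‖u₁ x * w x + u x * w₁ x + (v₁ x * z x + v x * z₁ x)‖ ^ 2 / (4 * B) -
        9 * k ^ 2 / B * ‖u x * w x + v x * z x‖ ^ 2) ≤
      ∫ x in (0 : ℝ)..T, (‖w₁ x‖ ^ 2 + ‖z₁ x‖ ^ 2 - k ^ 2 * (‖w x‖ ^ 2 + ‖z x‖ ^ 2)) := by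
  have hre {f f' : ℝ → ℂ} (h : ∀ x, HasDerivAt f (f' x) x) (x : ℝ) :
      HasDerivAt (fun x => (f x).re) (f' x).re x :=
    Complex.reCLM.hasFDerivAt.comp_hasDerivAt x (h x)
  have him {f f' : ℝ → ℂ} (h : ∀ x, HasDerivAt f (f' x) x) (x : ℝ) :
      HasDerivAt (fun x => (f x).im) (f' x).im x :=
    Complex.imCLM.hasFDerivAt.comp_hasDerivAt x (h x)
  -- As `u` and `v` are real, both sides split into the contributions of real and imaginary parts.
  have h1 := integral_energy_ge_real hB hA hAB hT hu hv hup hvp hud hvd (hre hw) (hre hz)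
    (Complex.continuous_re.comp hwc) (Complex.continuous_re.comp hzc)
    (fun x => congrArg Complex.re (hwp x)) (fun x => congrArg Complex.re (hzp x))
  have h2 := integral_energy_ge_real hB hA hAB hT hu hv hup hvp hud hvd (him hw) (him hz)
    (Complex.continuous_im.comp hwc) (Complex.continuous_im.comp hzc)
    (fun x => congrArg Complex.im (hwp x)) (fun x => congrArg Complex.im (hzp x))
  have hcont {f f' : ℝ → ℂ} (h : ∀ x, HasDerivAt f (f' x) x) : Continuous f :=
    continuous_iff_continuousAt.2 fun x => (h x).continuousAt
  have cu : Continuous u := continuous_iff_continuousAt.2 fun x => (hud x).continuousAt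
  have cv : Continuous v := continuous_iff_continuousAt.2 fun x => (hvd x).continuousAt
  have cw := hcont hw
  have cz := hcont hz
  have h3 := add_le_add h1 h2
  rw [← intervalIntegral.integral_add (Continuous.intervalIntegrable (by fun_prop) _ _)
      (Continuous.intervalIntegrable (by fun_prop) _ _),
    ← intervalIntegral.integral_add (Continuous.intervalIntegrable (by fun_prop) _ _)
      (Continuous.intervalIntegrable (by fun_prop) _ _)] at h3
  refine (le_of_eq ?_).trans (h3.trans (le_of_eq ?_))
  · refine intervalIntegral.integral_congr fun x _ => ?_
    simp only [Complex.sq_norm, Complex.normSq_apply, Complex.add_re, Complex.add_im,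
      Complex.re_ofReal_mul, Complex.im_ofReal_mul]
    ring
  · refine intervalIntegral.integral_congr fun x _ => ?_
    simp only [Complex.sq_norm, Complex.normSq_apply]
    ring

end Coercivity

/-! ### Nonnegativity of the energy -/

section Energy

open scoped InnerProductSpace ComplexConjugate

variable {T : ℝ}

/-- The trigonometric polynomial representing a partial sum. -/
def trigPoly (T : ℝ) (s : Finset ℤ) (a : ℤ → ℂ) (x : ℝ) : ℂ :=
  ∑ j ∈ s, a j * Complex.exp (Complex.I * freq T j * x)

lemma hasDerivAt_trigPoly (s : Finset ℤ) (a : ℤ → ℂ) (x : ℝ) :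
    HasDerivAt (trigPoly T s a) (trigPoly T s (fun j => a j * (Complex.I * freq T j)) x) x := by
  unfold trigPoly
  refine HasDerivAt.fun_sum fun j _ => ?_
  have h : HasDerivAt (fun x : ℝ => Complex.I * freq T j * (x : ℂ)) (Complex.I * freq T j) x := by
    simpa using (Complex.ofRealCLM.hasDerivAt (x := x)).const_mul (Complex.I * (freq T j : ℂ))
  refine HasDerivAt.congr_deriv (h.cexp.const_mul (a j)) ?_
  ring

lemma continuous_trigPoly (s : Finset ℤ) (a : ℤ → ℂ) : Continuous (trigPoly T s a) :=
  continuous_iff_continuousAt.2 fun x => (hasDerivAt_trigPoly s a x).continuousAt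

variable [hT : Fact (0 < T)]

lemma fourierCoeffOn_deriv {F F' : ℝ → ℂ} (hF : ∀ x, HasDerivAt F (F' x) x) (hc : Continuous F')
    (hp : Function.Periodic F T) (j : ℤ) :
    fourierCoeffOn hT.out F' j = Complex.I * freq T j * fourierCoeffOn hT.out F j := by
  have hT0 : (T : ℂ) ≠ 0 := by exact_mod_cast hT.out.ne'
  -- The integration-by-parts formula divides by `j`; the zero mode of F' vanishes by periodicity
  -- instead.
  rcases eq_or_ne j 0 with rfl | hj
  · rw [fourierCoeffOn_eq_integral]
    simp only [neg_zero, fourier_zero, one_smul, freq, Int.cast_zero, mul_zero, zero_div,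
      Complex.ofReal_zero, zero_mul]
    rw [intervalIntegral.integral_eq_sub_of_hasDerivAt (fun x _ => hF x)
      (hc.intervalIntegrable _ _), hp.eq, sub_self, smul_zero]
  · rw [fourierCoeffOn_of_hasDerivAt hT.out hj (fun x _ => hF x) (hc.intervalIntegrable _ _),
      hp.eq, freq]
    have : (j : ℂ) ≠ 0 := by exact_mod_cast hj
    have hπ : (π : ℂ) ≠ 0 := by exact_mod_cast Real.pi_ne_zero
    push_cast
    field_simp
    ring

lemma hasSum_sq_fourierCoeffOn_of_continuous {F : ℝ → ℂ} (hc : Continuous F) :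
    HasSum (fun j => ‖fourierCoeffOn hT.out F j‖ ^ 2) (T⁻¹ * ∫ x in (0 : ℝ)..T, ‖F x‖ ^ 2) := by
  obtain ⟨C, hC⟩ := (isCompact_Icc (a := (0 : ℝ)) (b := T)).exists_bound_of_continuousOn
    hc.continuousOn
  have h := hasSum_sq_fourierCoeffOn hT.out (f := F) <|
    MemLp.of_bound hc.aestronglyMeasurable C <|
      (ae_restrict_iff' measurableSet_Ioc).2 <|
        Filter.Eventually.of_forall fun x hx => hC x (Set.Ioc_subset_Icc_self hx)
  simpa using h

lemma hasSum_freq_sq_fourierCoeffOn {F F' : ℝ → ℂ} (hF : ∀ x, HasDerivAt F (F' x) x)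
    (hc : Continuous F') (hp : Function.Periodic F T) :
    HasSum (fun j => freq T j ^ 2 * ‖fourierCoeffOn hT.out F j‖ ^ 2)
      (T⁻¹ * ∫ x in (0 : ℝ)..T, ‖F' x‖ ^ 2) := by
  refine (hasSum_sq_fourierCoeffOn_of_continuous hc).congr_fun fun j => ?_
  rw [fourierCoeffOn_deriv hF hc hp, norm_mul, norm_mul, Complex.norm_I, one_mul,
    Complex.norm_real, mul_pow, Real.norm_eq_abs, sq_abs]

/-- The class `f` is that of the function on the circle induced by `F`. -/
def Represents (f : L2 T) (F : ℝ → ℂ) : Prop :=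
  ∃ G : AddCircle T → ℂ, f =ᵐ[haarAddCircle] G ∧ ∀ x : ℝ, G x = F x

lemma Represents.periodic {f : L2 T} {F : ℝ → ℂ} (h : Represents f F) : Function.Periodic F T := by
  obtain ⟨G, -, hG⟩ := h
  intro x
  rw [← hG, ← hG, AddCircle.coe_add_period]

lemma Represents.repr_eq {f : L2 T} {F : ℝ → ℂ} (h : Represents f F) (j : ℤ) :
    fourierBasis.repr f j = fourierCoeffOn hT.out F j := by
  obtain ⟨G, hf, hG⟩ := h
  rw [fourierBasis_repr, fourierCoeff_congr_ae hf, fourierCoeff_eq_intervalIntegral G j 0,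
    fourierCoeffOn_eq_integral, zero_add, sub_zero]
  congr 1
  refine intervalIntegral.integral_congr fun x _ => ?_
  simp only [hG, fourier_coe_apply]

lemma Represents.add {f g : L2 T} {F G : ℝ → ℂ} (hf : Represents f F) (hg : Represents g G) :
    Represents (f + g) (fun x => F x + G x) := by
  obtain ⟨F', hf, hF⟩ := hf
  obtain ⟨G', hg, hG⟩ := hg
  refine ⟨fun x => F' x + G' x, ?_, fun x => by simp only [hF, hG]⟩
  filter_upwards [Lp.coeFn_add f g, hf, hg] with x h1 h2 h3
  rw [h1, Pi.add_apply, h2, h3]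

lemma Represents.mulOp {g : ℝ → ℝ} (hg : Continuous g) (hp : Function.Periodic g T) {f : L2 T}
    {F : ℝ → ℂ} (hf : Represents f F) : Represents (mulOp g hg hp f) (fun x => g x * F x) := by
  obtain ⟨F', hf, hF⟩ := hf
  refine ⟨fun x => (hp.lift x : ℂ) * F' x, ?_, fun x => ?_⟩
  · filter_upwards [coeFn_mulOp hg hp f, hf] with x h1 h2
    rw [h1, h2]
  · simp only [hF]
    congr 2

/-- The partial sums of the Fourier series. -/
def truncate (s : Finset ℤ) (f : L2 T) : L2 T := ∑ j ∈ s, fourierBasis.repr f j • fourierBasis j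

lemma tendsto_truncate (f : L2 T) :
    Filter.Tendsto (fun s => truncate s f) Filter.atTop (nhds f) :=
  fourierBasis.hasSum_repr f

lemma repr_truncate (s : Finset ℤ) (f : L2 T) (j : ℤ) :
    fourierBasis.repr (truncate s f) j = if j ∈ s then fourierBasis.repr f j else 0 := by
  rw [truncate, fourierBasis.repr_apply_apply, inner_sum]
  simp only [inner_smul_right, orthonormal_iff_ite.1 (fourierBasis (T := T)).orthonormal, mul_ite,
    mul_one, mul_zero]
  rw [Finset.sum_ite_eq]

lemma represents_truncate (s : Finset ℤ) (f : L2 T) :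
    Represents (truncate s f) (trigPoly T s (fourierBasis.repr f)) := by
  have e : truncate s f = ContinuousMap.toLp (E := ℂ) 2 haarAddCircle ℂ
      (∑ j ∈ s, fourierBasis.repr f j • fourier j) := by
    rw [map_sum, truncate]
    refine Finset.sum_congr rfl fun j _ => ?_
    rw [map_smul, coe_fourierBasis, fourierLp]
  refine ⟨_, e ▸ ContinuousMap.coeFn_toLp haarAddCircle _, fun x => ?_⟩
  simp only [trigPoly, ContinuousMap.coe_sum, Finset.sum_apply, ContinuousMap.coe_smul,
    Pi.smul_apply, smul_eq_mul, fourier_coe_eq_exp]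

variable {B A k m : ℝ} {u v : ℝ → ℝ}

/-- The energy is nonnegative on perturbations with a continuously differentiable
representative. -/
lemma energy_nonneg_of_represents (hB : 0 < B) (hA : 0 ≤ A) (hAB : A ≤ B)
    (hu : ∀ x, u x = √B * Real.cos (k * x)) (hv : ∀ x, v x = √(B + A) * Real.sin (k * x))
    (huc : Continuous u) (hvc : Continuous v)
    (hup : Function.Periodic u T) (hvp : Function.Periodic v T)
    {r : ℤ → ℝ} (hr : ∀ j, 0 ≤ r j) (hrm : ∀ j, |freq T j| ≤ 6 * |k| → m ≤ r j)
    (hm : 9 * k ^ 2 ≤ 4 * m * B)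
    {w z : L2 T} {W Z W₁ Z₁ : ℝ → ℂ} (hw : Represents w W) (hz : Represents z Z)
    (hW : ∀ x, HasDerivAt W (W₁ x) x) (hZ : ∀ x, HasDerivAt Z (Z₁ x) x)
    (hW₁ : Continuous W₁) (hZ₁ : Continuous Z₁) {σ τ : ℝ}
    (hσ : HasSum (fun j => (freq T j ^ 2 - k ^ 2) / 2 *
      (‖fourierBasis.repr w j‖ ^ 2 + ‖fourierBasis.repr z j‖ ^ 2)) σ)
    (hτ : HasSum (fun j => r j *
      ‖fourierBasis.repr (mulOp u huc hup w + mulOp v hvc hvp z) j‖ ^ 2) τ) :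
    0 ≤ σ + 2 * τ := by
  have hf : Represents _ _ := (hw.mulOp huc hup).add (hz.mulOp hvc hvp)
  have hk (x : ℝ) : HasDerivAt (fun x => k * x) k x := by
    simpa using (hasDerivAt_id x).const_mul k
  set u₁ : ℝ → ℝ := fun x => √B * (-Real.sin (k * x) * k) with hu₁
  set v₁ : ℝ → ℝ := fun x => √(B + A) * (Real.cos (k * x) * k) with hv₁
  have hud (x : ℝ) : HasDerivAt u (u₁ x) x := by
    rw [funext hu]; exact (hk x).cos.const_mul _
  have hvd (x : ℝ) : HasDerivAt v (v₁ x) x := by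
    rw [funext hv]; exact (hk x).sin.const_mul _
  have hu₁c : Continuous u₁ := by fun_prop
  have hv₁c : Continuous v₁ := by fun_prop
  have hcont {f f' : ℝ → ℂ} (h : ∀ x, HasDerivAt f (f' x) x) : Continuous f :=
    continuous_iff_continuousAt.2 fun x => (h x).continuousAt
  have cW := hcont hW
  have cZ := hcont hZ
  have hFd (x : ℝ) : HasDerivAt (fun x => (u x : ℂ) * W x + v x * Z x)
      (u₁ x * W x + u x * W₁ x + (v₁ x * Z x + v x * Z₁ x)) x :=
    ((hud x).ofReal_comp.mul (hW x)).add ((hvd x).ofReal_comp.mul (hZ x))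
  have hge := integral_energy_ge hB hA hAB hT.out.le hu hv hup hvp hud hvd hu₁c hv₁c hW hZ hW₁ hZ₁
    hw.periodic hz.periodic
  have hF₁ : Continuous fun x => (u₁ x : ℂ) * W x + u x * W₁ x + (v₁ x * Z x + v x * Z₁ x) := by
    fun_prop
  have w1 := hasSum_freq_sq_fourierCoeffOn hW hW₁ hw.periodic
  have z1 := hasSum_freq_sq_fourierCoeffOn hZ hZ₁ hz.periodic
  have w0 := hasSum_sq_fourierCoeffOn_of_continuous (T := T) cW
  have z0 := hasSum_sq_fourierCoeffOn_of_continuous (T := T) cZ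
  have f1 := hasSum_freq_sq_fourierCoeffOn hFd hF₁ hf.periodic
  have f0 := hasSum_sq_fourierCoeffOn_of_continuous (T := T) (hcont hFd)
  simp only [hw.repr_eq, hz.repr_eq] at hσ
  simp only [hf.repr_eq] at hτ
  have eσ := (hσ.mul_left 2).unique
    (((w1.add z1).sub ((w0.add z0).mul_left (k ^ 2))).congr_fun fun j => by ring)
  have hsum := ((f1.mul_left (1 / (4 * B))).sub (f0.mul_left (9 * k ^ 2 / B))).add (hτ.mul_left 4)
  have hnn := hsum.nonneg fun j => by
    set c := ‖fourierCoeffOn hT.out (fun x => (u x : ℂ) * W x + v x * Z x) j‖ ^ 2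
    have hc : 0 ≤ c := sq_nonneg _
    have e : 1 / (4 * B) * (freq T j ^ 2 * c) - 9 * k ^ 2 / B * c + 4 * (r j * c) =
        (freq T j ^ 2 - 36 * k ^ 2 + 16 * (r j * B)) / (4 * B) * c := by
      field_simp; ring
    rw [e]
    refine mul_nonneg (div_nonneg ?_ (by positivity)) hc
    -- The bad term 36k² is beaten by freq² above 6|k|, and below it by 16 r B ≥ 16mB ≥ 36k².
    rcases le_or_gt |freq T j| (6 * |k|) with h | h
    · have := mul_le_mul_of_nonneg_right (hrm j h) hB.le
      nlinarith [sq_nonneg (freq T j)]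
    · have h1 := pow_le_pow_left₀ (by positivity) h.le 2
      rw [mul_pow, sq_abs, sq_abs] at h1
      have := mul_nonneg (hr j) hB.le
      linarith
  have hTi : 0 ≤ T⁻¹ := inv_nonneg.2 hT.out.le
  have hge' := mul_le_mul_of_nonneg_left hge hTi
  rw [intervalIntegral.integral_sub (Continuous.intervalIntegrable (by fun_prop) _ _)
      (Continuous.intervalIntegrable (by fun_prop) _ _),
    intervalIntegral.integral_sub (Continuous.intervalIntegrable (by fun_prop) _ _)
      (Continuous.intervalIntegrable (by fun_prop) _ _),
    intervalIntegral.integral_add (Continuous.intervalIntegrable (by fun_prop) _ _)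
      (Continuous.intervalIntegrable (by fun_prop) _ _),
    intervalIntegral.integral_const_mul, intervalIntegral.integral_const_mul,
    intervalIntegral.integral_add (Continuous.intervalIntegrable (by fun_prop) _ _)
      (Continuous.intervalIntegrable (by fun_prop) _ _),
    intervalIntegral.integral_div] at hge'
  have e1 : ∀ X Y : ℝ, T⁻¹ * (X / (4 * B) - 9 * k ^ 2 / B * Y) =
      1 / (4 * B) * (T⁻¹ * X) - 9 * k ^ 2 / B * (T⁻¹ * Y) := fun X Y => by ring
  rw [e1] at hge'
  linarith

end Energy

/-! ### From trigonometric polynomials to `H2` -/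

section EnergyH2

open scoped InnerProductSpace ComplexConjugate

variable {T : ℝ} [hT : Fact (0 < T)] {B A k m : ℝ} {u v ρ : ℝ → ℝ}

/-- The energy is nonnegative on all of `H2 × H2`. -/
lemma energy_nonneg_of_mem_H2 (hB : 0 < B) (hA : 0 ≤ A) (hAB : A ≤ B)
    (hu : ∀ x, u x = √B * Real.cos (k * x)) (hv : ∀ x, v x = √(B + A) * Real.sin (k * x))
    (huc : Continuous u) (hvc : Continuous v)
    (hup : Function.Periodic u T) (hvp : Function.Periodic v T)
    (hρ : Integrable ρ) (he : ∀ x, ρ (-x) = ρ x) (hpos : ∀ s, 0 ≤ (hat ρ s).re)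
    (hρm : ∀ s, |s| ≤ 6 * |k| → m ≤ (hat ρ s).re) (hm : 9 * k ^ 2 ≤ 4 * m * B)
    {S : H2 T →ₗ[ℂ] L2 T}
    (hS : ∀ f j, fourierBasis.repr (S f) j =
      (((freq T j ^ 2 - k ^ 2) / 2 : ℝ) : ℂ) * fourierBasis.repr (f : L2 T) j) (w z : H2 T) :
    0 ≤ (⟪(w : L2 T), S w⟫_ℂ).re + (⟪(z : L2 T), S z⟫_ℂ).re +
      2 * (⟪mulOp u huc hup w + mulOp v hvc hvp z,
        convOp ρ hρ (mulOp u huc hup w + mulOp v hvc hvp z)⟫_ℂ).re := by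
  -- On Fourier truncations, which are smooth, the local energy is a partial sum of a convergent
  -- series and the nonlocal energy is continuous in L², so the inequality passes to the limit.
  set c : ℤ → ℝ := fun j => (freq T j ^ 2 - k ^ 2) / 2 *
      (‖fourierBasis.repr (w : L2 T) j‖ ^ 2 + ‖fourierBasis.repr (z : L2 T) j‖ ^ 2) with hc
  set f : Finset ℤ → L2 T := fun s =>
    mulOp u huc hup (truncate s w) + mulOp v hvc hvp (truncate s z) with hf
  have hlim1 : Filter.Tendsto (fun s => ∑ j ∈ s, c j) Filter.atTop
      (nhds ((⟪(w : L2 T), S w⟫_ℂ).re + (⟪(z : L2 T), S z⟫_ℂ).re)) := by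
    have hcs : HasSum c ((⟪(w : L2 T), S w⟫_ℂ).re + (⟪(z : L2 T), S z⟫_ℂ).re) :=
      ((hasSum_re_inner_of_repr (hS w)).add (hasSum_re_inner_of_repr (hS z))).congr_fun
        fun j => mul_add _ _ _
    exact hcs
  have hlimf : Filter.Tendsto f Filter.atTop
      (nhds (mulOp u huc hup w + mulOp v hvc hvp z)) :=
    (((continuous_mulOp huc hup).tendsto _).comp (tendsto_truncate _)).add
      (((continuous_mulOp hvc hvp).tendsto _).comp (tendsto_truncate _))
  have hlim2 : Filter.Tendsto (fun s => (⟪f s, convOp ρ hρ (f s)⟫_ℂ).re) Filter.atTop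
      (nhds (⟪mulOp u huc hup w + mulOp v hvc hvp z,
        convOp ρ hρ (mulOp u huc hup w + mulOp v hvc hvp z)⟫_ℂ).re) :=
    (Complex.continuous_re.tendsto _).comp
      (hlimf.inner (((continuous_convOp hρ he).tendsto _).comp hlimf))
  refine ge_of_tendsto' (hlim1.add (hlim2.const_mul 2)) fun s => ?_
  have hτ := hasSum_re_inner_of_repr (repr_convOp_of_even hρ he (f s))
  have hσ : HasSum (fun j => (freq T j ^ 2 - k ^ 2) / 2 *
      (‖fourierBasis.repr (truncate s (w : L2 T)) j‖ ^ 2 +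
        ‖fourierBasis.repr (truncate s (z : L2 T)) j‖ ^ 2)) (∑ j ∈ s, c j) := by
    have h := hasSum_sum_of_ne_finset_zero (L := .unconditional ℤ)
      (f := fun j => if j ∈ s then c j else 0) (s := s) fun j hj => if_neg hj
    rw [Finset.sum_congr rfl fun j hj => if_pos hj] at h
    refine h.congr_fun fun j => ?_
    simp only [repr_truncate]
    split_ifs <;> simp [hc]
  exact energy_nonneg_of_represents hB hA hAB hu hv huc hvc hup hvp
    (fun j => hpos (freq T j)) (fun j => hρm (freq T j)) hm
    (represents_truncate s (w : L2 T)) (represents_truncate s (z : L2 T))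
    (hasDerivAt_trigPoly s _) (hasDerivAt_trigPoly s _)
    (continuous_trigPoly s _) (continuous_trigPoly s _) hσ hτ

end EnergyH2

/-! ### The linearization as a Hamiltonian operator -/

section Linearization

open scoped InnerProductSpace ComplexConjugate

/-- The complex structure `(w, z) ↦ (z, -w)`. -/
def symplectic (T : ℝ) [Fact (0 < T)] : L2Pair T →ₗ[ℂ] L2Pair T where
  toFun x := WithLp.toLp 2 (x.snd, -x.fst)
  map_add' _ _ := congrArg (WithLp.toLp 2) (Prod.ext rfl (neg_add _ _))
  map_smul' c _ := congrArg (WithLp.toLp 2) (Prod.ext rfl (smul_neg c _).symm)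

variable {ζ : ℝ → ℝ} {k ε B V₀ : ℝ} [hk : Fact (0 < k)]

/-- Because the potential is constant, all dependence of the linearization on position sits in the
bounded nonlocal part. -/
lemma repr_scalarPart (hζ : IsAdmissible ζ) (hε : 0 < ε) (hB : 0 ≤ B) (hV : V₀ ≤ 0) (n : ℕ+)
    (f : H2 (period k n)) (j : ℤ) :
    fourierBasis.repr (scalarPart hζ.integrable k ε B V₀ n f) j =
      (((freq (period k n) j ^ 2 - k ^ 2) / 2 : ℝ) : ℂ) *
        fourierBasis.repr (f : L2 (period k n)) j := by
  simp only [scalarPart, LinearMap.add_apply, LinearMap.smul_apply, LinearMap.comp_apply,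
    Submodule.subtype_apply, mulOp_of_eq_const _ _ (hζ.totalPotential_eq hε k hB hV), map_add,
    map_smul, lp.coeFn_add, Pi.add_apply, lp.coeFn_smul, Pi.smul_apply, smul_eq_mul,
    repr_secondDeriv]
  push_cast
  ring

/-- The density perturbation `u w + v z`. -/
def densityPert (ζ : ℝ → ℝ) (k ε B V₀ : ℝ) [Fact (0 < k)] (n : ℕ+) (x : L2Pair (period k n)) :
    L2 (period k n) :=
  mulRe k B n x.fst + mulIm ζ k ε B V₀ n x.snd

/-- The nonlocal part `(w, z) ↦ (2 u R ∗ (u w + v z), 2 v R ∗ (u w + v z))` of the energy. -/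
def nonlocalPart (hζ : Integrable ζ) (k ε B V₀ : ℝ) [Fact (0 < k)] (n : ℕ+) :
    L2Pair (period k n) →ₗ[ℂ] L2Pair (period k n) :=
  (WithLp.linearEquiv 2 ℂ (L2 (period k n) × L2 (period k n))).symm.toLinearMap ∘ₗ
    ((2 : ℂ) • (mulRe k B n).prod (mulIm ζ k ε B V₀ n)) ∘ₗ coupling hζ k ε B V₀ n ∘ₗ
      (WithLp.linearEquiv 2 ℂ (L2 (period k n) × L2 (period k n))).toLinearMap

/-- The nonlocal part factors as 2M*(R ∗ M), M being the map to the density perturbation, because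
multiplication by real `u` and `v` is symmetric. -/
lemma inner_nonlocalPart_left (hζ : Integrable ζ) (n : ℕ+) (x y : L2Pair (period k n)) :
    ⟪nonlocalPart hζ k ε B V₀ n x, y⟫_ℂ =
      2 * ⟪convOp (R ζ ε) (integrable_R hζ ε) (densityPert ζ k ε B V₀ n x),
        densityPert ζ k ε B V₀ n y⟫_ℂ := by
  rw [WithLp.prod_inner_apply]
  change ⟪(2 : ℂ) • mulRe k B n _, y.fst⟫_ℂ + ⟪(2 : ℂ) • mulIm ζ k ε B V₀ n _, y.snd⟫_ℂ = _
  rw [inner_smul_left, inner_smul_left, mulRe, mulIm, mulOp_symm, mulOp_symm, densityPert,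
    densityPert, inner_add_right, mul_add]
  simp only [map_ofNat]
  rfl

lemma inner_nonlocalPart_right (hζ : Integrable ζ) (n : ℕ+) (x y : L2Pair (period k n)) :
    ⟪x, nonlocalPart hζ k ε B V₀ n y⟫_ℂ =
      2 * ⟪densityPert ζ k ε B V₀ n x,
        convOp (R ζ ε) (integrable_R hζ ε) (densityPert ζ k ε B V₀ n y)⟫_ℂ := by
  rw [← inner_conj_symm, inner_nonlocalPart_left, map_mul, inner_conj_symm, map_ofNat]

lemma nonlocalPart_symm (hζ : IsAdmissible ζ) (n : ℕ+) :
    (nonlocalPart hζ.integrable k ε B V₀ n).IsSymmetric := fun x y => by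
  rw [inner_nonlocalPart_left, inner_nonlocalPart_right, convOp_symm _ (even_R hζ.even ε)]

/-- The local part `(w, z) ↦ (S w, S z)` of the energy. -/
def localPart (hζ : Integrable ζ) (k ε B V₀ : ℝ) [Fact (0 < k)] (n : ℕ+) :
    (JL hζ k ε B V₀ n).domain →ₗ[ℂ] L2Pair (period k n) where
  toFun x := WithLp.toLp 2
    (scalarPart hζ k ε B V₀ n ⟨x.1.fst, x.2.1⟩, scalarPart hζ k ε B V₀ n ⟨x.1.snd, x.2.2⟩)
  map_add' x y := congrArg (WithLp.toLp 2) <| Prod.ext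
    ((scalarPart hζ k ε B V₀ n).map_add ⟨x.1.fst, x.2.1⟩ ⟨y.1.fst, y.2.1⟩)
    ((scalarPart hζ k ε B V₀ n).map_add ⟨x.1.snd, x.2.2⟩ ⟨y.1.snd, y.2.2⟩)
  map_smul' c x := congrArg (WithLp.toLp 2) <| Prod.ext
    ((scalarPart hζ k ε B V₀ n).map_smul c ⟨x.1.fst, x.2.1⟩)
    ((scalarPart hζ k ε B V₀ n).map_smul c ⟨x.1.snd, x.2.2⟩)

lemma isNonnegHamiltonian_JL (hζ : IsAdmissible ζ) (hε : 0 < ε) (hV : V₀ ≤ 0) {m : ℝ}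
    (hm : ∀ s : ℝ, |s| ≤ 6 * |k| → m ≤ (hat (R ζ ε) s).re) (hB : 0 < B)
    (hAB : A ζ k ε V₀ ≤ B) (hmB : 9 * k ^ 2 ≤ 4 * m * B) (n : ℕ+) :
    IsNonnegHamiltonian (symplectic (period k n)) (JL hζ.integrable k ε B V₀ n)
      (localPart hζ.integrable k ε B V₀ n)
      ⟨nonlocalPart hζ.integrable k ε B V₀ n, (nonlocalPart_symm hζ n).continuous⟩ := by
  have hrepr := repr_scalarPart (k := k) (B := B) hζ hε hB.le hV n
  refine ⟨fun x => ?_, fun x y => ?_, fun x hx => ?_, fun x => ?_, fun x => ?_, fun x y => ?_,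
    nonlocalPart_symm hζ n, fun x => ?_⟩
  · rfl
  · rw [WithLp.prod_inner_apply, WithLp.prod_inner_apply]
    change ⟪x.snd, y.fst⟫_ℂ + ⟪-x.fst, y.snd⟫_ℂ = -(⟪x.fst, y.snd⟫_ℂ + ⟪x.snd, -y.fst⟫_ℂ)
    rw [inner_neg_left, inner_neg_right]
    ring
  · exact ⟨hx.2, neg_mem hx.1⟩
  · exact congrArg (WithLp.toLp 2) <| Prod.ext rfl
      ((scalarPart hζ.integrable k ε B V₀ n).map_neg ⟨x.1.fst, x.2.1⟩)
  · rfl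
  · rw [WithLp.prod_inner_apply, WithLp.prod_inner_apply]
    exact congrArg₂ (· + ·) (inner_eq_of_repr (hrepr _) (hrepr _))
      (inner_eq_of_repr (hrepr _) (hrepr _))
  · have h := energy_nonneg_of_mem_H2 hB (div_nonneg (neg_nonneg.2 hV) (hζ.β_pos hε k).le) hAB
      (fun _ => rfl) (fun _ => rfl) (continuous_waveRe k B) (continuous_waveIm ζ k ε B V₀)
      (periodic_waveRe k B n) (periodic_waveIm ζ k ε B V₀ n) (integrable_R hζ.integrable ε)
      (even_R hζ.even ε) (fun s => (hζ.hat_R_re_pos hε s).le) hm hmB hrepr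
      ⟨x.1.fst, x.2.1⟩ ⟨x.1.snd, x.2.2⟩
    have e : ⟪(x : L2Pair (period k n)), localPart hζ.integrable k ε B V₀ n x +
        nonlocalPart hζ.integrable k ε B V₀ n x⟫_ℂ =
        ⟪x.1.fst, scalarPart hζ.integrable k ε B V₀ n ⟨x.1.fst, x.2.1⟩⟫_ℂ +
        ⟪x.1.snd, scalarPart hζ.integrable k ε B V₀ n ⟨x.1.snd, x.2.2⟩⟫_ℂ +
        2 * ⟪densityPert ζ k ε B V₀ n x, convOp (R ζ ε) (integrable_R hζ.integrable ε)
          (densityPert ζ k ε B V₀ n x)⟫_ℂ := by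
      rw [inner_add_right, inner_nonlocalPart_right, WithLp.prod_inner_apply]
      rfl
    have e' := congrArg Complex.re e
    rw [Complex.add_re, Complex.add_re, ← Complex.ofReal_ofNat, Complex.re_ofReal_mul] at e'
    exact h.trans_eq e'.symm

/-- The principal part minus a nonimaginary number is onto. -/
lemma surjective_localPart_sub (hζ : IsAdmissible ζ) (hε : 0 < ε) (hB : 0 ≤ B) (hV : V₀ ≤ 0)
    (n : ℕ+) {μ : ℂ} (hμ : μ.re ≠ 0) (f : L2Pair (period k n)) :
    ∃ x : (JL hζ.integrable k ε B V₀ n).domain,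
      symplectic (period k n) (localPart hζ.integrable k ε B V₀ n x) -
        μ • (x : L2Pair (period k n)) = f := by
  set S := scalarPart hζ.integrable k ε B V₀ n
  have hrepr := repr_scalarPart (k := k) (B := B) hζ hε hB hV n
  -- In the variables `w ± i z` the operator is diagonal.
  obtain ⟨a, ha⟩ := surjective_sub_of_repr hrepr (ν := Complex.I * μ) (by simpa using hμ)
    (Complex.I • (f.fst + Complex.I • f.snd))
  obtain ⟨b, hb⟩ := surjective_sub_of_repr hrepr (ν := -(Complex.I * μ)) (by simpa using hμ)
    (-(Complex.I • (f.fst - Complex.I • f.snd)))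
  -- This inverts a = w + iz, b = w - iz. The spectral parameters ±iμ used for `a` and `b` are
  -- nonreal exactly because Re μ ≠ 0.
  let w : H2 (period k n) := (1 / 2 : ℂ) • (a + b)
  let z : H2 (period k n) := (-Complex.I / 2 : ℂ) • (a - b)
  have hSa : S a = (Complex.I * μ) • (a : L2 (period k n)) +
      Complex.I • (f.fst + Complex.I • f.snd) := by rw [← ha]; abel
  have hSb : S b = -(Complex.I * μ) • (b : L2 (period k n)) -
      Complex.I • (f.fst - Complex.I • f.snd) := by rw [sub_eq_add_neg, ← hb]; abel
  refine ⟨⟨WithLp.toLp 2 ((w : L2 (period k n)), (z : L2 (period k n))), w.2, z.2⟩, ?_⟩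
  have h1 : S z - μ • (w : L2 (period k n)) = f.fst := by
    simp only [w, z, map_smul, map_sub, hSa, hSb, Submodule.coe_smul, Submodule.coe_add]
    match_scalars <;> ring_nf <;> simp only [Complex.I_sq] <;> ring
  have h2 : -S w - μ • (z : L2 (period k n)) = f.snd := by
    simp only [w, z, map_smul, map_add, hSa, hSb, Submodule.coe_smul, Submodule.coe_sub]
    match_scalars <;> ring_nf <;> simp only [Complex.I_sq] <;> ring
  exact congrArg (WithLp.toLp 2) (Prod.ext h1 h2)

end Linearization

end NonlocalGP

end

theorem theorem2 (ζ : ℝ → ℝ) (hζ : NonlocalGP.IsAdmissible ζ)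
    (k : ℝ) [Fact (0 < k)] (ε : ℝ) (hε : 0 < ε) :
    ∃ Bmin : ℝ, ∃ v : ℝ, 0 < v ∧
      ∀ B : ℝ, Bmin < B → ∀ V₀ : ℝ, V₀ < 0 → |V₀| < v →
        ∀ n : ℕ+, ∀ μ ∈ NonlocalGP.spectrumOf (NonlocalGP.JL hζ.integrable k ε B V₀ n),
          μ.re = 0 := by
  have hβ := hζ.β_pos hε k
  obtain ⟨m, hm0, hm⟩ := hζ.exists_le_hat_R hε (6 * |k|)
  -- The bound |V₀| < β gives A < 1, and B > 1 then gives A ≤ B; the other entry of the maximum is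
  -- the condition 4mB > 9k².
  refine ⟨max 1 (9 * k ^ 2 / (4 * m)), NonlocalGP.β ζ k ε, hβ, fun B hB V₀ hV₀ hV n μ hμ => ?_⟩
  obtain ⟨hB1, hBm⟩ := max_lt_iff.1 hB
  have hB0 : 0 < B := one_pos.trans hB1
  rw [div_lt_iff₀ (by positivity)] at hBm
  have hA : NonlocalGP.A ζ k ε V₀ ≤ B := by
    rw [abs_of_neg hV₀] at hV
    exact ((div_lt_one hβ).2 hV).le.trans hB1.le
  exact (NonlocalGP.isNonnegHamiltonian_JL hζ hε hV₀.le hm hB0 hA (by linarith)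
    n).re_eq_zero_of_mem_spectrumOf
      (fun ν hν f => NonlocalGP.surjective_localPart_sub hζ hε hB0.le hV₀.le n hν f) hμ
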